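/- Let $h>0$, $\omega_0>1$, $\mathbb{H}_h=\{\omega\in\mathbb{C}:\operatorname{Im}\omega>-h\}$, and let $H^2$ be the Hardy space of functions $f$ analytic in $\mathbb{H}_h$ with $\|f\|:=\sup_{y>-h}\|f\|_{L^2(\mathbb{R}+iy)}<\infty$ (equivalently, $\|f\|$ is the $L^2$ norm of the boundary values of $f$ on $\mathbb{R}-ih$). For $\epsilon>0$ put $$D_h^0(\epsilon)=\sup\{|f(\omega_0)| : f\in H^2,\ \|f\|\le 1,\ \|f\|_{L^2(-1,1)}\le\epsilon\},\qquad \gamma(h)=\liminf_{\epsilon\to0^+}\frac{\ln D_h^0(\epsilon)}{\ln\epsilon},$$ $$p_{a}(\omega)=\frac{i}{2\pi(\omega-\overline{a}+2ih)},\qquad (\mathcal{K}u)(\omega)=\int_{-1}^1p_x(\omega)u(x)\,dx .$$ Let $\eta=\eta(\epsilon)>0$ denote the solution of $$\|(\mathcal{K}+\eta)^{-1}p_{\omega_0}\|_{L^2(-1,1)}=\epsilon\,\|(\mathcal{K}+\eta)^{-1}p_{\omega_0}\|,$$ and let $u^*=u^*_\epsilon\in H^2$ be the solution of $(\mathcal{K}+\eta(\epsilon))u^*=p_{\omega_0}$.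 (0) Let $\epsilon_*=\|p_{\omega_0}\|_{L^2(-1,1)}/\|p_{\omega_0}\|$. Then $0<\epsilon_*<1$; for each $\epsilon\in(0,\epsilon_*)$ the solution $\eta(\epsilon)>0$ exists and is unique, while there is no solution for any other $\epsilon$. For $t\ge\epsilon_*$ we read $\eta(t)=+\infty$, that is, the integrands below are $0$ wherever $\eta$ does not exist. (1) For every $\epsilon\in(0,1]$ the integrand below is integrable on $[\epsilon,1]$ and $$D_h^0(\epsilon)=D_h^0(1)\,\exp\left\{-\int_\epsilon^1\frac{t\,dt}{t^2+\eta(t)}\right\}.$$ (2) The power law exponent satisfies $$\gamma(h)=\liminf_{\epsilon\to0^+}\frac{\ln\left(\left(\epsilon+\frac{\eta(\epsilon)}{\epsilon}\right)\|u^*_\epsilon\|_{L^2(-1,1)}\right)}{\ln\epsilon}=\liminf_{t\to+\infty}\frac1t\int_0^t\frac{dx}{1+e^{2x}\eta(e^{-x})},$$ where the last integrand is integrable on $[0,t]$ for every $t\ge0$. -/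

import Mathlib

noncomputable section

namespace HardyExtrapolation

open scoped ENNReal

/-- The half-plane `ℍ_h = {ω : Im ω > -h}`. -/
def halfPlane (h : ℝ) : Set ℂ := {z : ℂ | -h < z.im}

/-- The Hardy norm `sup_{y > -h} ‖f‖_{L²(ℝ + iy)}` (finite or `∞`). For `f ∈ H²(ℍ_h)` it is the
`L²` norm of the boundary values of `f` on `ℝ - ih`. -/
def hardyNorm (h : ℝ) (f : ℂ → ℂ) : ℝ≥0∞ :=
  ⨆ (y : ℝ) (_ : -h < y),
    MeasureTheory.eLpNorm (fun x : ℝ => f ((x : ℂ) + (y : ℂ) * Complex.I)) 2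
      MeasureTheory.volume

/-- The Hardy space `H²(ℍ_h)`: analytic in `ℍ_h`, with uniformly bounded `L²` norms on the
horizontal lines in `ℍ_h`. -/
structure MemH2 (h : ℝ) (f : ℂ → ℂ) : Prop where
  analytic : DifferentiableOn ℂ f (halfPlane h)
  bounded : hardyNorm h f < ⊤

/-- The norm `‖f‖_{L²(-1,1)}` of the restriction of `f` to the real interval `(-1,1)`. -/
def intervalNorm (f : ℂ → ℂ) : ℝ≥0∞ :=
  MeasureTheory.eLpNorm (fun x : ℝ => f (x : ℂ)) 2
    (MeasureTheory.volume.restrict (Set.Ioo (-1 : ℝ) 1))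

/-- The kernel `p_a(ω) = i / (2π (ω - conj a + 2ih))`. -/
def kernelP (h : ℝ) (a ω : ℂ) : ℂ :=
  Complex.I / (2 * (Real.pi : ℂ) * (ω - starRingEnd ℂ a + 2 * Complex.I * (h : ℂ)))

/-- The integral operator `(𝒦u)(ω) = ∫_{-1}^{1} p_x(ω) u(x) dx`. -/
def opK (h : ℝ) (u : ℂ → ℂ) (ω : ℂ) : ℂ :=
  ∫ x in (-1 : ℝ)..1, kernelP h (x : ℂ) ω * u (x : ℂ)

/-- `D_h^0(ε) = sup {|f(ω₀)| : f ∈ H²(ℍ_h), ‖f‖ ≤ 1, ‖f‖_{L²(-1,1)} ≤ ε}`. -/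
def extremalD (h ω₀ ε : ℝ) : ℝ :=
  sSup {r : ℝ | ∃ f : ℂ → ℂ, MemH2 h f ∧ hardyNorm h f ≤ 1 ∧
    intervalNorm f ≤ ENNReal.ofReal ε ∧ r = ‖f (ω₀ : ℂ)‖}

/-- `u = (𝒦 + η)⁻¹ p_{ω₀}` in `H²(ℍ_h)`. -/
structure IsResolventSol (h ω₀ η : ℝ) (u : ℂ → ℂ) : Prop where
  mem : MemH2 h u
  eqn : ∀ ω ∈ halfPlane h, opK h u ω + (η : ℂ) * u ω = kernelP h (ω₀ : ℂ) ω

/-- `η > 0` and `‖(𝒦 + η)⁻¹ p_{ω₀}‖_{L²(-1,1)} = ε ‖(𝒦 + η)⁻¹ p_{ω₀}‖`. -/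
def IsEta (h ω₀ ε η : ℝ) : Prop :=
  0 < η ∧ ∃ u : ℂ → ℂ, IsResolventSol h ω₀ η u ∧
    intervalNorm u = ENNReal.ofReal ε * hardyNorm h u

/-- The threshold `ε_* = ‖p_{ω₀}‖_{L²(-1,1)} / ‖p_{ω₀}‖`. -/
def epsStar (h ω₀ : ℝ) : ℝ :=
  (intervalNorm (kernelP h (ω₀ : ℂ))).toReal / (hardyNorm h (kernelP h (ω₀ : ℂ))).toReal

/-- The set of `ε` for which the equation for `η` has a positive solution. -/
def solvable (h ω₀ : ℝ) : Set ℝ := {ε : ℝ | ∃ e : ℝ, IsEta h ω₀ ε e}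

/-- The power law exponent `γ(h) = liminf_{ε → 0⁺} ln D_h^0(ε) / ln ε`, as an extended real. -/
def gammaExp (h ω₀ : ℝ) : EReal :=
  Filter.liminf (fun ε : ℝ => ((Real.log (extremalD h ω₀ ε) / Real.log ε : ℝ) : EReal))
    (nhdsWithin 0 (Set.Ioi 0))

/-- The integrand `t / (t² + η(t))`, read as `0` (`η = +∞`) where `η(t)` does not exist. -/
def integrand (h ω₀ : ℝ) (η : ℝ → ℝ) : ℝ → ℝ :=
  Set.indicator (solvable h ω₀) (fun t : ℝ => t / (t ^ 2 + η t))

/-- The function `r(x) = 1 / (1 + e^{2x} η(e^{-x}))`, read as `0` (`η = +∞`) where `η(e^{-x})`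
does not exist. -/
def ratioFn (h ω₀ : ℝ) (η : ℝ → ℝ) : ℝ → ℝ :=
  Set.indicator {x : ℝ | Real.exp (-x) ∈ solvable h ω₀}
    (fun x : ℝ => 1 / (1 + Real.exp (2 * x) * η (Real.exp (-x))))

end HardyExtrapolation

end

/-!
The theorem is an instance of Tikhonov regularization in a Hilbert space. The Laplace transform
`g ↦ ∫₀^∞ e^{2πi s (ω + ih)} g(s) ds` is an isometry of `L²(0, ∞)` into the Hardy space
(`hardyNorm_laplace`, from Plancherel's theorem on horizontal lines), evaluation at `a` is the inner
product with the density of `p_a` (`inner_kernelVec`), and `𝒦 = R†R`, where `R` is the restriction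
to `(-1, 1)` (`laplace_adjoint_intervalRestrict`). Solutions of the resolvent equation are
automatically Laplace transforms (`IsResolventSol.eq_laplace`). A general function of Hardy class
need only be one after a translation into the half-plane: Cauchy's formula on the boundary line
shows that `f(· + iδ)` is the transform of a density of norm at most `‖f‖`
(`exists_density_of_shift`), and inequalities for `f` follow as `δ → 0`
(`norm_apply_le_of_density`).

In the Hilbert space put `u = (R†R + η)⁻¹ p`. Then `⟨f, p⟩ = ⟨Rf, Ru⟩ + η ⟨f, u⟩`, hence
`|⟨f, p⟩| ≤ ‖Rf‖ ‖Ru‖ + η ‖f‖ ‖u‖`, with equality at `f = u`. So the extremal function `D` lies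
below the line `x ↦ x ‖Ru‖ + η ‖u‖` and touches it at `x = ‖Ru‖ / ‖u‖`, where the value is
`(x² + η) ‖u‖`; its derivative there is `‖Ru‖`, and the logarithmic derivative is `x / (x² + η)`.
Integration gives the exact formula, and `x = e^{-t}` the formulas for the exponent.

The equation for `η` is `‖Ru‖ / ‖u‖ = ε`. The left side is continuous in `η`, and injective: equal
values make both vectors extremal, so the Cauchy-Schwarz inequality makes them proportional, and
then `p` is an eigenvector of `R†R`. This is impossible, because the powers of
`2ih / (ω - ω₀ + 2ih)` equal `1` at `ω₀` and tend to `0` uniformly on `(-1, 1)`. The same functions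
force `‖u‖ → ∞`, hence `‖Ru‖ / ‖u‖ → 0`, as `η → 0`, and the limit as `η → ∞` is `ε_*`
(`image_normRatio`).
-/

noncomputable section

namespace HardyExtrapolation

open scoped ENNReal
open Filter Topology MeasureTheory

/-! ### Regularized solutions in a Hilbert space -/

section Abstract

variable {E L : Type*} [NormedAddCommGroup E] [InnerProductSpace ℂ E] [CompleteSpace E]
  [NormedAddCommGroup L] [InnerProductSpace ℂ L] [CompleteSpace L]

/-- The operator `R†R + η`. -/
def shiftedGram (R : E →L[ℂ] L) (η : ℝ) : E →L[ℂ] E :=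
  R.adjoint ∘L R + (η : ℂ) • ContinuousLinearMap.id ℂ E

/-- The vector `(R†R + η)⁻¹ p` for `η > 0` (and `0` where `R†R + η` is not invertible). -/
def regVec (R : E →L[ℂ] L) (p : E) (η : ℝ) : E := Ring.inverse (shiftedGram R η) p

variable (R : E →L[ℂ] L) (p : E)

theorem inner_shiftedGram (η : ℝ) (f g : E) :
    inner ℂ f (shiftedGram R η g) = inner ℂ (R f) (R g) + η * inner ℂ f g := by
  simp [shiftedGram, ContinuousLinearMap.adjoint_inner_right]

theorem re_inner_shiftedGram_self (η : ℝ) (f : E) :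
    (inner ℂ f (shiftedGram R η f)).re = ‖R f‖ ^ 2 + η * ‖f‖ ^ 2 := by
  rw [inner_shiftedGram, inner_self_eq_norm_sq_to_K, inner_self_eq_norm_sq_to_K]
  norm_cast
  simp [-Complex.ofReal_pow]

theorem isUnit_shiftedGram {η : ℝ} (hη : 0 < η) : IsUnit (shiftedGram R η) := by
  refine ContinuousLinearMap.isUnit_of_forall_le_norm_inner_map (c := ⟨η, hη.le⟩) _ hη fun x => ?_
  have h1 := re_inner_shiftedGram_self R η x
  rw [norm_inner_symm]
  refine le_trans ?_ (Complex.re_le_norm _)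
  rw [h1]
  change ‖x‖ ^ 2 * η ≤ _
  nlinarith [sq_nonneg ‖R x‖]

theorem shiftedGram_regVec {η : ℝ} (hη : 0 < η) : shiftedGram R η (regVec R p η) = p := by
  have := Ring.mul_inverse_cancel _ (isUnit_shiftedGram R hη)
  exact congrArg (fun A : E →L[ℂ] E => A p) this

theorem eq_regVec {η : ℝ} (hη : 0 < η) {u : E} (hu : shiftedGram R η u = p) :
    u = regVec R p η := by
  have := Ring.inverse_mul_cancel _ (isUnit_shiftedGram R hη)
  rw [regVec, ← hu]
  exact (congrArg (fun A : E →L[ℂ] E => A u) this).symm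

theorem continuousOn_regVec : ContinuousOn (regVec R p) (Set.Ioi 0) := by
  intro η hη
  refine ContinuousAt.continuousWithinAt ?_
  have h1 : ContinuousAt (fun η : ℝ => shiftedGram R η) η := by
    unfold shiftedGram; fun_prop
  have h2 : ContinuousAt Ring.inverse (shiftedGram R η) := by
    obtain ⟨v, hv⟩ := isUnit_shiftedGram R (show 0 < η from hη)
    rw [← hv]; exact NormedRing.inverse_continuousAt v
  have h3 : ContinuousAt (fun η : ℝ => Ring.inverse (shiftedGram R η)) η :=
    ContinuousAt.comp (f := fun η : ℝ => shiftedGram R η) h2 h1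
  exact h3.clm_apply continuousAt_const

theorem inner_vec_eq {η : ℝ} (hη : 0 < η) (f : E) :
    inner ℂ f p = inner ℂ (R f) (R (regVec R p η)) + η * inner ℂ f (regVec R p η) := by
  rw [← inner_shiftedGram, shiftedGram_regVec R p hη]

/-- The dual bound: each `η > 0` gives an upper bound for `|⟨p, f⟩|` in terms of `‖R f‖` and
`‖f‖`. -/
theorem norm_inner_le {η : ℝ} (hη : 0 < η) (f : E) :
    ‖inner ℂ p f‖ ≤ ‖R (regVec R p η)‖ * ‖R f‖ + η * ‖regVec R p η‖ * ‖f‖ := by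
  rw [norm_inner_symm, inner_vec_eq R p hη f]
  refine (norm_add_le _ _).trans ?_
  rw [norm_mul, Complex.norm_real, Real.norm_of_nonneg hη.le]
  have h1 := norm_inner_le_norm (𝕜 := ℂ) (R f) (R (regVec R p η))
  have h2 := mul_le_mul_of_nonneg_left (norm_inner_le_norm (𝕜 := ℂ) f (regVec R p η)) hη.le
  linarith

/-- The dual bound is attained at `f = (R†R + η)⁻¹ p`. -/
theorem norm_inner_regVec {η : ℝ} (hη : 0 < η) :
    ‖inner ℂ p (regVec R p η)‖ = ‖R (regVec R p η)‖ ^ 2 + η * ‖regVec R p η‖ ^ 2 := by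
  refine le_antisymm ((norm_inner_le R p hη _).trans_eq (by ring)) ?_
  have h := re_inner_shiftedGram_self R η (regVec R p η)
  rw [shiftedGram_regVec R p hη] at h
  rw [← h, norm_inner_symm]
  exact Complex.re_le_norm _

variable {R p}

theorem map_regVec_ne_zero (hRp : R p ≠ 0) {η : ℝ} (hη : 0 < η) : R (regVec R p η) ≠ 0 := by
  intro h0
  apply hRp
  have h := shiftedGram_regVec R p hη
  simp only [shiftedGram, add_apply, ContinuousLinearMap.comp_apply, h0,
    map_zero, zero_add, smul_apply, ContinuousLinearMap.id_apply] at h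
  rw [← h, map_smul, h0, smul_zero]

theorem regVec_ne_zero (hRp : R p ≠ 0) {η : ℝ} (hη : 0 < η) : regVec R p η ≠ 0 := by
  intro h0
  apply map_regVec_ne_zero hRp hη
  rw [h0, map_zero]

variable (R p)

/-- The ratio `‖R u‖ / ‖u‖` at `u = (R†R + η)⁻¹ p`. -/
def normRatio (η : ℝ) : ℝ := ‖R (regVec R p η)‖ / ‖regVec R p η‖

variable {R p}

theorem normRatio_pos (hRp : R p ≠ 0) {η : ℝ} (hη : 0 < η) : 0 < normRatio R p η :=
  div_pos (norm_pos_iff.2 (map_regVec_ne_zero hRp hη)) (norm_pos_iff.2 (regVec_ne_zero hRp hη))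

theorem norm_map_regVec (hRp : R p ≠ 0) {η : ℝ} (hη : 0 < η) :
    ‖R (regVec R p η)‖ = normRatio R p η * ‖regVec R p η‖ := by
  rw [normRatio, div_mul_cancel₀ _ (norm_ne_zero_iff.2 (regVec_ne_zero hRp hη))]

theorem continuousOn_normRatio (hRp : R p ≠ 0) : ContinuousOn (normRatio R p) (Set.Ioi 0) :=
  ((R.continuous.comp_continuousOn (continuousOn_regVec R p)).norm).div
    (continuousOn_regVec R p).norm fun _ hη => norm_ne_zero_iff.2 (regVec_ne_zero hRp hη)

/-- If functionals of norm one at `p` can be almost invisible to `R`, then `p` is not an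
eigenvector of `R†R`. -/
theorem not_eigenvector (hRp : R p ≠ 0)
    (H : ∀ δ > 0, ∃ f : E, inner ℂ p f = 1 ∧ ‖R f‖ < δ) (l : ℂ) :
    R.adjoint (R p) ≠ l • p := by
  intro hl
  have hl0 : l = 0 := by
    by_contra h0
    have hpos : 0 < ‖R p‖ := norm_pos_iff.2 hRp
    obtain ⟨f, hf, hfR⟩ := H (‖l‖ / ‖R p‖) (div_pos (norm_pos_iff.2 h0) hpos)
    have h1 : inner ℂ f (R.adjoint (R p)) = l := by
      rw [hl, inner_smul_right, ← inner_conj_symm, hf]; simp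
    rw [ContinuousLinearMap.adjoint_inner_right] at h1
    have h2 := norm_inner_le_norm (𝕜 := ℂ) (R f) (R p)
    rw [h1] at h2
    rw [lt_div_iff₀ hpos] at hfR
    exact absurd (lt_of_le_of_lt h2 hfR) (lt_irrefl _)
  rw [hl0, zero_smul] at hl
  have h3 : inner ℂ p (R.adjoint (R p)) = 0 := by rw [hl, inner_zero_right]
  rw [ContinuousLinearMap.adjoint_inner_right, inner_self_eq_zero] at h3
  exact hRp h3

/-- Two regularized vectors with the same ratio solve the same extremal problem, so they are
proportional; unless the parameters agree, `p` would then be an eigenvector of `R†R`. -/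
theorem injOn_normRatio (hRp : R p ≠ 0)
    (H : ∀ δ > 0, ∃ f : E, inner ℂ p f = 1 ∧ ‖R f‖ < δ) :
    Set.InjOn (normRatio R p) (Set.Ioi 0) := by
  intro η₁ h1 η₂ h2 heq
  rw [Set.mem_Ioi] at h1 h2
  set u₁ := regVec R p η₁ with hu₁
  set u₂ := regVec R p η₂ with hu₂
  set ε := normRatio R p η₁ with hε
  have hn1 : ‖R u₁‖ = ε * ‖u₁‖ := norm_map_regVec hRp h1
  have hn2 : ‖R u₂‖ = ε * ‖u₂‖ := by rw [heq]; exact norm_map_regVec hRp h2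
  have p1 : 0 < ‖u₁‖ := norm_pos_iff.2 (regVec_ne_zero hRp h1)
  have p2 : 0 < ‖u₂‖ := norm_pos_iff.2 (regVec_ne_zero hRp h2)
  have e1 := norm_inner_regVec R p h1
  have e2 := norm_inner_regVec R p h2
  have b1 := norm_inner_le R p h1 u₂
  rw [← hu₁] at e1 b1
  rw [← hu₂] at e2
  rw [hn1] at e1
  rw [hn2] at e2
  rw [e2, hn1, hn2] at b1
  -- the dual bound at `η₁` applied to `u₂`, then the identity for `⟨u₁, p⟩` at `η₂`, make
  -- Cauchy-Schwarz an equality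
  have c1 : (ε ^ 2 + η₂) * ‖u₂‖ ≤ (ε ^ 2 + η₁) * ‖u₁‖ := by
    have : ((ε ^ 2 + η₂) * ‖u₂‖) * ‖u₂‖ ≤ ((ε ^ 2 + η₁) * ‖u₁‖) * ‖u₂‖ := by nlinarith
    exact le_of_mul_le_mul_right this p2
  have c2 : ‖u₁‖ * ‖u₂‖ ≤ ‖inner ℂ u₁ u₂‖ := by
    have h3 : ‖inner ℂ p u₁‖ ≤ ε ^ 2 * ‖u₁‖ * ‖u₂‖ + η₂ * ‖inner ℂ u₁ u₂‖ := by
      rw [norm_inner_symm, inner_vec_eq R p h2 u₁, ← hu₂]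
      refine (norm_add_le _ _).trans ?_
      rw [norm_mul, Complex.norm_real, Real.norm_of_nonneg h2.le]
      have h4 := norm_inner_le_norm (𝕜 := ℂ) (R u₁) (R u₂)
      rw [hn1, hn2] at h4
      nlinarith
    rw [e1] at h3
    have h5 := mul_le_mul_of_nonneg_right c1 p1.le
    have h6 : η₂ * (‖u₁‖ * ‖u₂‖) ≤ η₂ * ‖inner ℂ u₁ u₂‖ := by nlinarith
    exact le_of_mul_le_mul_left h6 h2
  have c3 : ‖inner ℂ u₁ u₂‖ = ‖u₁‖ * ‖u₂‖ := le_antisymm (norm_inner_le_norm _ _) c2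
  obtain h0 | ⟨r, hr⟩ := ((norm_inner_eq_norm_tfae ℂ u₁ u₂).out 0 2).1 c3
  · exact absurd h0 (regVec_ne_zero hRp h1)
  have s1 : R.adjoint (R u₁) + (η₁ : ℂ) • u₁ = p := shiftedGram_regVec R p h1
  have s2 : R.adjoint (R u₂) + (η₂ : ℂ) • u₂ = p := shiftedGram_regVec R p h2
  rw [hr, map_smul, map_smul] at s2
  have s3 : (r - 1) • R.adjoint (R u₁) = ((η₁ : ℂ) - η₂ * r) • u₁ := by
    have := s2.trans s1.symm
    rw [sub_smul, sub_smul, one_smul, sub_eq_sub_iff_add_eq_add, mul_smul, this, add_comm]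
  by_cases hr1 : r = 1
  · rw [hr1, sub_self, zero_smul, mul_one] at s3
    have := (smul_eq_zero.1 s3.symm).resolve_right (regVec_ne_zero hRp h1)
    exact_mod_cast sub_eq_zero.1 this
  · exfalso
    have hr1' : r - 1 ≠ 0 := sub_ne_zero.2 hr1
    set l : ℂ := (r - 1)⁻¹ * ((η₁ : ℂ) - η₂ * r) with hl
    have s4 : R.adjoint (R u₁) = l • u₁ := by
      rw [hl, mul_smul, ← s3, smul_smul, inv_mul_cancel₀ hr1', one_smul]
    refine not_eigenvector hRp H l ?_
    rw [← s1]
    simp only [map_add, map_smul]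
    rw [s4, smul_add, map_smul, map_smul, s4, smul_comm l (η₁ : ℂ)]

theorem norm_regVec_le {η : ℝ} (hη : 0 < η) : η * ‖regVec R p η‖ ≤ ‖p‖ := by
  rcases (norm_nonneg (regVec R p η)).eq_or_lt with h0 | h0
  · rw [← h0, mul_zero]; exact norm_nonneg _
  have h1 := norm_inner_regVec R p hη
  have h2 := norm_inner_le_norm (𝕜 := ℂ) p (regVec R p η)
  rw [h1] at h2
  refine le_of_mul_le_mul_right ?_ h0
  nlinarith [sq_nonneg ‖R (regVec R p η)‖]

theorem tendsto_smul_regVec_atTop :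
    Tendsto (fun η : ℝ => (η : ℂ) • regVec R p η) atTop (𝓝 p) := by
  have h0 : Tendsto (fun η : ℝ => regVec R p η) atTop (𝓝 0) := by
    rw [tendsto_zero_iff_norm_tendsto_zero]
    refine squeeze_zero' (Eventually.of_forall fun _ => norm_nonneg _) ?_
      (tendsto_const_nhds (x := ‖p‖) |>.div_atTop tendsto_id)
    filter_upwards [eventually_gt_atTop 0] with η hη
    rw [id, le_div_iff₀ hη, mul_comm]
    exact norm_regVec_le hη
  have h1 : Tendsto (fun η : ℝ => p - R.adjoint (R (regVec R p η))) atTop (𝓝 p) := by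
    have := ((R.adjoint ∘L R).continuous.tendsto 0).comp h0
    simpa using (tendsto_const_nhds (x := p)).sub this
  refine h1.congr' ?_
  filter_upwards [eventually_gt_atTop 0] with η hη
  have s1 : R.adjoint (R (regVec R p η)) + (η : ℂ) • regVec R p η = p := shiftedGram_regVec R p hη
  rw [eq_comm, eq_sub_iff_add_eq, add_comm, s1]

theorem tendsto_normRatio_atTop (hRp : R p ≠ 0) :
    Tendsto (normRatio R p) atTop (𝓝 (‖R p‖ / ‖p‖)) := by
  have hp : p ≠ 0 := fun h => hRp (by rw [h, map_zero])
  have h1 := (tendsto_smul_regVec_atTop (R := R) (p := p))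
  have h2 := ((R.continuous.tendsto p).comp h1).norm.div h1.norm (norm_ne_zero_iff.2 hp)
  refine h2.congr' ?_
  filter_upwards [eventually_gt_atTop 0] with η hη
  have : ‖(η : ℂ)‖ ≠ 0 := by simpa using hη.ne'
  simp only [Function.comp_apply, map_smul, norm_smul, normRatio]
  exact mul_div_mul_left _ _ this

/-- As `η → 0` the vectors `u = (R†R + η)⁻¹ p` blow up, and `‖R u‖² ≤ ‖R†R u‖ ‖u‖` then forces
`‖R u‖ / ‖u‖ → 0`. -/
theorem tendsto_normRatio_zero (hRp : R p ≠ 0)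
    (H : ∀ δ > 0, ∃ f : E, inner ℂ p f = 1 ∧ ‖R f‖ < δ) :
    Tendsto (normRatio R p) (𝓝[>] 0) (𝓝 0) := by
  have hinv : Tendsto (fun η => ‖regVec R p η‖⁻¹) (𝓝[>] 0) (𝓝 0) := by
    rw [Metric.tendsto_nhds]
    intro δ hδ
    obtain ⟨f, hf, hfR⟩ := H (δ / (2 * (‖R‖ + 1))) (by positivity)
    have hlim : Tendsto (fun η : ℝ => η * ‖f‖) (𝓝[>] 0) (𝓝 0) := by
      have : Tendsto (fun η : ℝ => η * ‖f‖) (𝓝 0) (𝓝 (0 * ‖f‖)) := tendsto_id.mul_const _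
      rw [zero_mul] at this
      exact this.mono_left nhdsWithin_le_nhds
    filter_upwards [hlim.eventually (gt_mem_nhds (show (0 : ℝ) < δ / 2 by positivity)),
      self_mem_nhdsWithin] with η hη1 hη
    have p1 : 0 < ‖regVec R p η‖ := norm_pos_iff.2 (regVec_ne_zero hRp hη)
    have b := norm_inner_le R p hη f
    rw [hf, norm_one] at b
    have b1 : ‖R (regVec R p η)‖ ≤ (‖R‖ + 1) * ‖regVec R p η‖ :=
      (R.le_opNorm _).trans (by nlinarith)
    have b2 : ‖R (regVec R p η)‖ * ‖R f‖ ≤ δ / 2 * ‖regVec R p η‖ := by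
      calc _ ≤ ((‖R‖ + 1) * ‖regVec R p η‖) * (δ / (2 * (‖R‖ + 1))) :=
            mul_le_mul b1 hfR.le (norm_nonneg _) (by positivity)
        _ = _ := by field_simp
    rw [Real.dist_eq, sub_zero, abs_of_pos (inv_pos.2 p1), inv_lt_comm₀ p1 hδ]
    rw [inv_lt_iff_one_lt_mul₀ hδ]
    nlinarith
  have hb : Tendsto (fun η => Real.sqrt (‖p‖ * ‖regVec R p η‖⁻¹ + η)) (𝓝[>] 0) (𝓝 0) := by
    have h1 : Tendsto (fun η => ‖p‖ * ‖regVec R p η‖⁻¹ + η) (𝓝[>] 0) (𝓝 (‖p‖ * 0 + 0)) :=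
      (hinv.const_mul _).add (tendsto_id.mono_left nhdsWithin_le_nhds)
    have := (Real.continuous_sqrt.tendsto _).comp h1
    simpa [Function.comp_def] using this
  refine squeeze_zero' ?_ ?_ hb
  · filter_upwards [self_mem_nhdsWithin] with η hη using (normRatio_pos hRp hη).le
  filter_upwards [self_mem_nhdsWithin] with η hη
  have hη' : 0 < η := hη
  have p1 : 0 < ‖regVec R p η‖ := norm_pos_iff.2 (regVec_ne_zero hRp hη)
  have s1 : R.adjoint (R (regVec R p η)) + (η : ℂ) • regVec R p η = p := shiftedGram_regVec R p hη
  have s2 : ‖R.adjoint (R (regVec R p η))‖ ≤ ‖p‖ + η * ‖regVec R p η‖ := by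
    rw [eq_sub_of_add_eq s1]
    refine (norm_sub_le _ _).trans ?_
    rw [norm_smul, Complex.norm_real, Real.norm_of_nonneg hη'.le]
  have s3 : ‖R (regVec R p η)‖ ^ 2 ≤ ‖R.adjoint (R (regVec R p η))‖ * ‖regVec R p η‖ := by
    have := norm_inner_le_norm (𝕜 := ℂ) (R.adjoint (R (regVec R p η))) (regVec R p η)
    rw [ContinuousLinearMap.adjoint_inner_left, inner_self_eq_norm_sq_to_K] at this
    simpa using this
  refine Real.le_sqrt_of_sq_le ?_
  rw [normRatio, div_pow, div_le_iff₀ (by positivity)]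
  have : (‖p‖ * ‖regVec R p η‖⁻¹ + η) * ‖regVec R p η‖ ^ 2 =
      (‖p‖ + η * ‖regVec R p η‖) * ‖regVec R p η‖ := by field_simp
  rw [this]
  exact s3.trans (mul_le_mul_of_nonneg_right s2 p1.le)

theorem strictMonoOn_normRatio (hRp : R p ≠ 0)
    (H : ∀ δ > 0, ∃ f : E, inner ℂ p f = 1 ∧ ‖R f‖ < δ) :
    StrictMonoOn (normRatio R p) (Set.Ioi 0) := by
  -- pass to the variable `log η` to have a function on the whole line
  have hmem : ∀ x : ℝ, Real.exp x ∈ Set.Ioi (0 : ℝ) := fun x => Real.exp_pos x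
  have hc : Continuous fun x => normRatio R p (Real.exp x) :=
    (continuousOn_normRatio hRp).comp_continuous Real.continuous_exp hmem
  have hi : Function.Injective fun x => normRatio R p (Real.exp x) := fun x y hxy =>
    Real.exp_injective (injOn_normRatio hRp H (hmem x) (hmem y) hxy)
  have hexp : Tendsto Real.exp atBot (𝓝[>] 0) := Real.tendsto_exp_atBot_nhdsGT
  have hbot := (tendsto_normRatio_zero hRp H).comp hexp
  rcases hc.strictMono_of_inj hi with hm | hm
  · intro x hx y hy hxy
    have := hm (Real.log_lt_log hx hxy)
    simpa only [Real.exp_log (show 0 < x from hx), Real.exp_log (show 0 < y from hy)] using this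
  · have h1 : normRatio R p (Real.exp 0) ≤ 0 := by
      refine ge_of_tendsto hbot ?_
      filter_upwards [eventually_le_atBot 0] with x hx using hm.antitone hx
    exact absurd (normRatio_pos hRp (Real.exp_pos 0)) h1.not_gt

theorem image_normRatio (hRp : R p ≠ 0)
    (H : ∀ δ > 0, ∃ f : E, inner ℂ p f = 1 ∧ ‖R f‖ < δ) :
    normRatio R p '' Set.Ioi 0 = Set.Ioo 0 (‖R p‖ / ‖p‖) := by
  have hm := strictMonoOn_normRatio hRp H
  ext ε
  constructor
  · rintro ⟨η, hη, rfl⟩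
    have hη' : 0 < η := hη
    refine ⟨normRatio_pos hRp hη, ?_⟩
    refine (hm hη (show η + 1 ∈ Set.Ioi 0 from by simp; linarith) (lt_add_one η)).trans_le ?_
    refine ge_of_tendsto (tendsto_normRatio_atTop hRp) ?_
    filter_upwards [eventually_ge_atTop (η + 1)] with x hx
    exact hm.monotoneOn (by simp; linarith) (by simp; linarith) hx
  · rintro ⟨h0, h1⟩
    have hpc : IsPreconnected (Set.Ioi (0 : ℝ)) := isPreconnected_Ioi
    exact hpc.intermediate_value_Ioo (l₁ := 𝓝[>] 0) (l₂ := atTop)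
      (le_principal_iff.2 self_mem_nhdsWithin) (le_principal_iff.2 (Ioi_mem_atTop 0))
      (continuousOn_normRatio hRp) (tendsto_normRatio_zero hRp H)
      (tendsto_normRatio_atTop hRp) ⟨h0, h1⟩

end Abstract

/-! ### Plancherel for integrable functions -/

theorem continuous_fourierInv {G : ℝ → ℂ} (h1 : Integrable G) :
    Continuous (FourierTransformInv.fourierInv G) := by
  refine VectorFourier.fourierIntegral_continuous Real.continuous_fourierChar ?_ h1
  simp; fun_prop

theorem integral_fourierInv_smul {φ : ℝ → ℂ} {G : ℝ → ℂ} (h0 : Integrable φ) (h1 : Integrable G) :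
    ∫ x, FourierTransformInv.fourierInv φ x • G x =
      ∫ x, φ x • FourierTransformInv.fourierInv G x := by
  have hflip : (-innerₗ ℝ : ℝ →ₗ[ℝ] ℝ →ₗ[ℝ] ℝ).flip = -innerₗ ℝ := by
    ext; simp
  have := VectorFourier.integral_fourierIntegral_smul_eq_flip (e := Real.fourierChar)
    (μ := (volume : Measure ℝ)) (ν := volume) (L := -innerₗ ℝ)
    Real.continuous_fourierChar (by simp; fun_prop) h0 h1
  rw [hflip] at this
  exact this

/-- The inverse Fourier transform on `L²` is symmetric for the bilinear pairing with Schwartz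
functions. -/
theorem integral_smul_fourierInv_Lp (φ : SchwartzMap ℝ ℂ) (F : Lp ℂ 2 (volume : Measure ℝ)) :
    ∫ x, φ x • (Lp.fourierTransformₗᵢ ℝ ℂ).symm F x =
      ∫ x, FourierTransformInv.fourierInv (φ : ℝ → ℂ) x • F x := by
  have e1 := congrArg (fun T => T φ) (MeasureTheory.Lp.fourierInv_toTemperedDistribution_eq F)
  simp only [TemperedDistribution.fourierInv_apply,
    MeasureTheory.Lp.toTemperedDistribution_apply, SchwartzMap.fourierInv_coe] at e1
  exact e1.symm

/-- The `L²` inverse Fourier transform of an integrable square-integrable function is given by the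
Fourier integral; both have the same pairings with test functions. -/
theorem fourierInv_toLp_ae_eq {G : ℝ → ℂ} (h1 : Integrable G) (h2 : MemLp G 2) :
    (Lp.fourierTransformₗᵢ ℝ ℂ).symm h2.toLp =ᵐ[volume] FourierTransformInv.fourierInv G := by
  refine ae_eq_of_integral_contDiff_smul_eq
    ((Lp.memLp _).locallyIntegrable (by norm_num)) (continuous_fourierInv h1).locallyIntegrable ?_
  intro g hg hgc
  have hgc' : HasCompactSupport (fun x => (g x : ℂ)) := 
    hgc.comp_left (g := fun y : ℝ => (y : ℂ)) Complex.ofReal_zero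
  have hg' : ContDiff ℝ ((⊤ : ℕ∞) : WithTop ℕ∞) (fun x => (g x : ℂ)) :=
    Complex.ofRealCLM.contDiff.comp hg
  have e1 := integral_smul_fourierInv_Lp (hgc'.toSchwartzMap hg') h2.toLp
  have e2 : ∫ x, FourierTransformInv.fourierInv (fun x => (g x : ℂ)) x • (h2.toLp : ℝ → ℂ) x =
      ∫ x, FourierTransformInv.fourierInv (fun x => (g x : ℂ)) x • G x := by
    refine integral_congr_ae ?_
    filter_upwards [h2.coeFn_toLp] with x hx
    rw [hx]
  have e3 : ∫ x, (g x : ℂ) • (Lp.fourierTransformₗᵢ ℝ ℂ).symm h2.toLp x =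
      ∫ x, (g x : ℂ) • FourierTransformInv.fourierInv G x :=
    e1.trans (e2.trans (integral_fourierInv_smul (hgc'.toSchwartzMap hg').integrable h1))
  simpa only [Complex.coe_smul] using e3

/-- Plancherel's theorem for integrable square-integrable functions. -/
theorem eLpNorm_fourierInv {G : ℝ → ℂ} (h1 : Integrable G) (h2 : MemLp G 2) :
    eLpNorm (FourierTransformInv.fourierInv G) 2 volume = eLpNorm G 2 volume := by
  rw [← eLpNorm_congr_ae (fourierInv_toLp_ae_eq h1 h2), ← eLpNorm_congr_ae h2.coeFn_toLp,
    ← Lp.enorm_def, ← Lp.enorm_def]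
  exact (Lp.fourierTransformₗᵢ ℝ ℂ).symm.enorm_map _

/-! ### Functions of one real variable -/

/-- A function lying below its affine touching functions, with continuously varying slopes, is
differentiable with these slopes as derivative. -/
theorem hasDerivAt_of_touching {D s : ℝ → ℝ} {S : Set ℝ} (hS : IsOpen S)
    (htouch : ∀ y ∈ S, ∀ x ∈ S, D x ≤ D y + s y * (x - y)) (hs : ContinuousOn s S)
    {y : ℝ} (hy : y ∈ S) : HasDerivAt D (s y) y := by
  rw [hasDerivAt_iff_isLittleO, Asymptotics.isLittleO_iff]
  intro c hc
  have h1 : ∀ᶠ x in 𝓝 y, |s x - s y| < c := by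
    have := (hs.continuousAt (hS.mem_nhds hy)).tendsto
    exact (Metric.tendsto_nhds.1 this c hc)
  filter_upwards [h1, hS.mem_nhds hy] with x hx hxS
  have a1 := htouch y hy x hxS
  have a2 := htouch x hxS y hy
  have a3 : |(s x - s y) * (x - y)| ≤ c * |x - y| := by
    rw [abs_mul]; exact mul_le_mul_of_nonneg_right hx.le (abs_nonneg _)
  have a4 := neg_abs_le ((s x - s y) * (x - y))
  rw [Real.norm_eq_abs, Real.norm_eq_abs, smul_eq_mul, abs_le]
  constructor <;> nlinarith [abs_nonneg (x - y)]

/-- The fundamental theorem of calculus for a function with a bounded derivative off one point. -/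
theorem integral_eq_sub_of_bounded_deriv {f f' : ℝ → ℝ} {a b c M : ℝ} (hab : a ≤ b)
    (hf : ContinuousOn f (Set.Icc a b))
    (hd : ∀ x ∈ Set.Ioo a b, x ≠ c → HasDerivAt f (f' x) x)
    (hm : AEStronglyMeasurable f' volume) (hM : ∀ x ∈ Set.Icc a b, |f' x| ≤ M) :
    IntervalIntegrable f' volume a b ∧ ∫ x in a..b, f' x = f b - f a := by
  have hi : IntervalIntegrable f' volume a b := by
    refine IntervalIntegrable.mono_fun (f := f') (g := f') ?_ hm.restrict (by rfl)
    rw [intervalIntegrable_iff_integrableOn_Ioc_of_le hab]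
    refine Measure.integrableOn_of_bounded (M := M) (by simp) hm ?_
    filter_upwards [ae_restrict_mem measurableSet_Ioc] with x hx
    exact hM x (Set.Ioc_subset_Icc_self hx)
  exact ⟨hi, integral_eq_of_hasDerivAt_off_countable_of_le f f' hab
    (Set.countable_singleton c) hf (fun x hx => hd x hx.1 hx.2) hi⟩

theorem aestronglyMeasurable_indicator_of_continuousOn {S : Set ℝ} (hS : IsOpen S) {q : ℝ → ℝ}
    (hq : ContinuousOn q S) : AEStronglyMeasurable (S.indicator q) volume :=
  (aestronglyMeasurable_indicator_iff hS.measurableSet).2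
    (hq.aestronglyMeasurable hS.measurableSet)

/-- A function `ψ` with derivative `q` on `(0, e)` and constant on `[e, ∞)` is recovered from `q`
extended by zero. The bound on `t q(t)` gives integrability away from `0`. -/
theorem integral_indicator_eq_sub {ψ q : ℝ → ℝ} {e : ℝ} (hψ : ContinuousOn ψ (Set.Ioi 0))
    (hd : ∀ t ∈ Set.Ioo 0 e, HasDerivAt ψ (q t) t) (hconst : ∀ t, e ≤ t → ψ t = ψ e)
    (hq : ContinuousOn q (Set.Ioo 0 e)) (hq0 : ∀ t ∈ Set.Ioo 0 e, |t * q t| ≤ 1)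
    {a b : ℝ} (ha : 0 < a) (hab : a ≤ b) :
    IntervalIntegrable ((Set.Ioo 0 e).indicator q) volume a b ∧
      ∫ t in a..b, (Set.Ioo 0 e).indicator q t = ψ b - ψ a := by
  refine integral_eq_sub_of_bounded_deriv (c := e) (M := 1 / a) hab
    (hψ.mono fun t ht => ha.trans_le ht.1) ?_
    (aestronglyMeasurable_indicator_of_continuousOn isOpen_Ioo hq) ?_
  · intro t ht hte
    rcases lt_or_gt_of_ne hte with h | h
    · have hmem : t ∈ Set.Ioo 0 e := ⟨ha.trans ht.1, h⟩
      rw [Set.indicator_of_mem hmem]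
      exact hd t hmem
    · rw [Set.indicator_of_notMem (fun hm => absurd hm.2 h.le.not_gt)]
      refine (hasDerivAt_const t (ψ e)).congr_of_eventuallyEq ?_
      filter_upwards [lt_mem_nhds h] with s hs using hconst s hs.le
  · intro t ht
    have ht0 : 0 < t := ha.trans_le ht.1
    by_cases hm : t ∈ Set.Ioo 0 e
    · rw [Set.indicator_of_mem hm]
      have := hq0 t hm
      rw [abs_mul, abs_of_pos ht0] at this
      rw [le_div_iff₀ ha]
      nlinarith [abs_nonneg (q t), ht.1]
    · rw [Set.indicator_of_notMem hm, abs_zero]; positivity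

/-- The previous formula after the substitution `t = e^{-x}`. -/
theorem integral_indicator_exp_eq_sub {ψ q : ℝ → ℝ} {e : ℝ} (hψ : ContinuousOn ψ (Set.Ioi 0))
    (hd : ∀ t ∈ Set.Ioo 0 e, HasDerivAt ψ (q t) t) (hconst : ∀ t, e ≤ t → ψ t = ψ e)
    (hq : ContinuousOn q (Set.Ioo 0 e)) (hq0 : ∀ t ∈ Set.Ioo 0 e, |t * q t| ≤ 1)
    {b : ℝ} (hb : 0 ≤ b) :
    IntervalIntegrable ({x : ℝ | Real.exp (-x) ∈ Set.Ioo 0 e}.indicator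
        fun x => Real.exp (-x) * q (Real.exp (-x))) volume 0 b ∧
      ∫ x in (0 : ℝ)..b, {x : ℝ | Real.exp (-x) ∈ Set.Ioo 0 e}.indicator
        (fun x => Real.exp (-x) * q (Real.exp (-x))) x = ψ 1 - ψ (Real.exp (-b)) := by
  have hcexp : Continuous fun x : ℝ => Real.exp (-x) := by fun_prop
  have hopen : IsOpen {x : ℝ | Real.exp (-x) ∈ Set.Ioo 0 e} := isOpen_Ioo.preimage hcexp
  have key := integral_eq_sub_of_bounded_deriv (f := fun x => -ψ (Real.exp (-x)))
    (f' := {x : ℝ | Real.exp (-x) ∈ Set.Ioo 0 e}.indicator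
        fun x => Real.exp (-x) * q (Real.exp (-x))) (c := -Real.log e) (M := 1) hb ?_ ?_ ?_ ?_
  · refine ⟨key.1, key.2.trans ?_⟩
    simp only [neg_zero, Real.exp_zero]; ring
  · exact (hψ.comp hcexp.continuousOn fun x _ => Real.exp_pos _).neg
  · intro x _ hx
    have hne : Real.exp (-x) ≠ e := by
      intro h; apply hx; rw [← h, Real.log_exp, neg_neg]
    have hex : HasDerivAt (fun x : ℝ => Real.exp (-x)) (-Real.exp (-x)) x := by
      simpa using (hasDerivAt_neg x).exp
    rcases lt_or_gt_of_ne hne with h | h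
    · have hmem : Real.exp (-x) ∈ Set.Ioo 0 e := ⟨Real.exp_pos _, h⟩
      rw [Set.indicator_of_mem (show x ∈ {x : ℝ | Real.exp (-x) ∈ Set.Ioo 0 e} from hmem)]
      have := ((hd _ hmem).comp x hex).neg
      convert! this using 1
      ring
    · rw [Set.indicator_of_notMem (fun hm => absurd hm.2 h.le.not_gt)]
      refine (hasDerivAt_const x (-ψ e)).congr_of_eventuallyEq ?_
      filter_upwards [hcexp.continuousAt.eventually (lt_mem_nhds h)] with s hs
      rw [hconst _ hs.le]
  · refine aestronglyMeasurable_indicator_of_continuousOn hopen ?_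
    exact hcexp.continuousOn.mul (hq.comp hcexp.continuousOn fun x hx => hx)
  · intro x _
    by_cases hm : x ∈ {x : ℝ | Real.exp (-x) ∈ Set.Ioo 0 e}
    · rw [Set.indicator_of_mem hm]; exact hq0 _ hm
    · rw [Set.indicator_of_notMem hm, abs_zero]; exact zero_le_one

theorem liminf_coe_le_of_tendsto_sub {α : Type*} {l : Filter α} [l.NeBot] {f g : α → ℝ}
    (h : Tendsto (fun x => g x - f x) l (𝓝 0)) :
    liminf (fun x => (f x : EReal)) l ≤ liminf (fun x => (g x : EReal)) l := by
  have h0 : liminf (fun x => ((g x - f x : ℝ) : EReal)) l = 0 := by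
    have : Tendsto (fun x => ((g x - f x : ℝ) : EReal)) l (𝓝 ((0 : ℝ) : EReal)) :=
      EReal.tendsto_coe.2 h
    exact this.liminf_eq
  have h1 := EReal.le_liminf_add (f := l) (u := fun x => (f x : EReal))
    (v := fun x => ((g x - f x : ℝ) : EReal))
  rw [h0, add_zero] at h1
  refine h1.trans_eq (congrArg (fun w => liminf w l) ?_)
  funext x
  rw [Pi.add_apply, ← EReal.coe_add, add_sub_cancel]

theorem liminf_coe_eq_of_tendsto_sub {α : Type*} {l : Filter α} [l.NeBot] {f g : α → ℝ}
    (h : Tendsto (fun x => g x - f x) l (𝓝 0)) :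
    liminf (fun x => (f x : EReal)) l = liminf (fun x => (g x : EReal)) l := by
  refine le_antisymm (liminf_coe_le_of_tendsto_sub h) (liminf_coe_le_of_tendsto_sub ?_)
  simpa using h.neg

/-- For `ψ(e^{-t}) = C - ∫₀ᵗ r`, the lower limit of `ψ(ε) / ln ε` at `0⁺` is that of the means
of `r` over `[0, t]`. -/
theorem liminf_div_log_eq {ψ r : ℝ → ℝ} {C : ℝ}
    (h : ∀ t : ℝ, 0 ≤ t → ∫ x in (0 : ℝ)..t, r x = C - ψ (Real.exp (-t))) :
    liminf (fun ε : ℝ => ((ψ ε / Real.log ε : ℝ) : EReal)) (𝓝[>] 0) =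
      liminf (fun t : ℝ => (((1 / t) * ∫ x in (0 : ℝ)..t, r x : ℝ) : EReal)) atTop := by
  have hmap : map (fun t : ℝ => Real.exp (-t)) atTop = 𝓝[>] 0 := by
    rw [← Real.map_exp_atBot, ← map_neg_atTop, map_map]; rfl
  rw [← hmap, ← liminf_comp]
  refine liminf_coe_eq_of_tendsto_sub
    (f := fun t => ψ (Real.exp (-t)) / Real.log (Real.exp (-t))) ?_
  have hlim : Tendsto (fun t : ℝ => C / t) atTop (𝓝 0) := tendsto_const_nhds.div_atTop tendsto_id
  refine hlim.congr' ?_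
  filter_upwards [eventually_gt_atTop 0] with t ht
  rw [h t ht.le, Real.log_exp]
  field_simp
  ring

/-! ### Exponentials on the half-line -/

theorem norm_cexp_mul (c : ℂ) (s : ℝ) : ‖Complex.exp (c * s)‖ = Real.exp (c.re * s) := by
  rw [Complex.norm_exp, Complex.re_mul_ofReal]

theorem pow_le_exp_mul {k s : ℝ} (hk : 0 < k) (hs : 0 ≤ s) (n : ℕ) :
    s ^ n ≤ n.factorial / k ^ n * Real.exp (k * s) := by
  have h := Real.pow_div_factorial_le_exp _ (mul_nonneg hk.le hs) n
  have hn : (0 : ℝ) < n.factorial := by positivity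
  rw [div_le_iff₀ hn, mul_pow] at h
  rw [div_mul_eq_mul_div, le_div_iff₀ (by positivity)]
  linarith

theorem norm_pow_mul_cexp_le {c : ℂ} (hc : c.re < 0) (n : ℕ) {s : ℝ} (hs : 0 ≤ s) :
    ‖(s : ℂ) ^ n * Complex.exp (c * s)‖ ≤
      n.factorial / (-c.re / 2) ^ n * Real.exp (c.re / 2 * s) := by
  rw [norm_mul, norm_cexp_mul, norm_pow, Complex.norm_real, Real.norm_of_nonneg hs]
  calc s ^ n * Real.exp (c.re * s)
      ≤ (n.factorial / (-c.re / 2) ^ n * Real.exp (-c.re / 2 * s)) * Real.exp (c.re * s) :=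
        mul_le_mul_of_nonneg_right (pow_le_exp_mul (by linarith) hs n) (Real.exp_pos _).le
    _ = _ := by rw [mul_assoc, ← Real.exp_add]; ring_nf

theorem memLp_exp_mul {k : ℝ} (hk : k < 0) :
    MemLp (fun s : ℝ => Real.exp (k * s)) 2 (volume.restrict (Set.Ioi 0)) := by
  rw [memLp_two_iff_integrable_sq (by fun_prop)]
  have := integrableOn_exp_mul_Ioi (a := 2 * k) (by linarith) 0
  refine this.congr (Eventually.of_forall fun s => ?_)
  simp only [← Real.exp_nat_mul]
  congr 1; push_cast; ring

theorem memLp_pow_mul_cexp {c : ℂ} (hc : c.re < 0) (n : ℕ) :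
    MemLp (fun s : ℝ => (s : ℂ) ^ n * Complex.exp (c * s)) 2 (volume.restrict (Set.Ioi 0)) := by
  refine ((memLp_exp_mul (k := c.re / 2) (by linarith)).const_mul
    (n.factorial / (-c.re / 2) ^ n)).mono' (by fun_prop) ?_
  filter_upwards [ae_restrict_mem measurableSet_Ioi] with s hs
  exact norm_pow_mul_cexp_le hc n (le_of_lt hs)

theorem memLp_cexp {c : ℂ} (hc : c.re < 0) :
    MemLp (fun s : ℝ => Complex.exp (c * s)) 2 (volume.restrict (Set.Ioi 0)) := by
  simpa using memLp_pow_mul_cexp hc 0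

theorem integrableOn_pow_mul_cexp {c : ℂ} (hc : c.re < 0) (n : ℕ) :
    IntegrableOn (fun s : ℝ => (s : ℂ) ^ n * Complex.exp (c * s)) (Set.Ioi 0) := by
  refine Integrable.mono' ((integrableOn_exp_mul_Ioi (a := c.re / 2) (by linarith) 0).const_mul
    (n.factorial / (-c.re / 2) ^ n)) (by fun_prop) ?_
  filter_upwards [ae_restrict_mem measurableSet_Ioi] with s hs
  exact norm_pow_mul_cexp_le hc n (le_of_lt hs)

theorem integral_pow_mul_cexp {c : ℂ} (hc : c.re < 0) (n : ℕ) :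
    ∫ s : ℝ in Set.Ioi 0, (s : ℂ) ^ n * Complex.exp (c * s) = n.factorial / (-c) ^ (n + 1) := by
  have hc0 : c ≠ 0 := fun h => by simp [h] at hc
  induction n with
  | zero =>
    have := integral_exp_mul_complex_Ioi hc 0
    simp only [pow_zero, one_mul, this]
    simp [div_eq_mul_inv, inv_neg]
  | succ n ih =>
    have hderiv : ∀ s ∈ Set.Ici (0 : ℝ), HasDerivAt
        (fun s : ℝ => (s : ℂ) ^ (n + 1) * Complex.exp (c * s))
        ((n + 1) * ((s : ℂ) ^ n * Complex.exp (c * s)) +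
          c * ((s : ℂ) ^ (n + 1) * Complex.exp (c * s))) s := by
      intro s _
      have h1 : HasDerivAt (fun z : ℂ => z ^ (n + 1) * Complex.exp (c * z))
          (((n + 1 : ℕ) : ℂ) * (s : ℂ) ^ n * Complex.exp (c * s) +
            (s : ℂ) ^ (n + 1) * (Complex.exp (c * s) * (c * 1))) (s : ℂ) := by
        have := hasDerivAt_pow (n + 1) (s : ℂ)
        exact this.mul (((hasDerivAt_id (s : ℂ)).const_mul c).cexp)
      convert! h1.comp_ofReal using 1
      push_cast; ring
    have hlim : Tendsto (fun s : ℝ => (s : ℂ) ^ (n + 1) * Complex.exp (c * s)) atTop (𝓝 0) := by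
      rw [tendsto_zero_iff_norm_tendsto_zero]
      have h1 : Tendsto (fun s : ℝ => (n + 1).factorial / (-c.re / 2) ^ (n + 1) *
          Real.exp (c.re / 2 * s)) atTop (𝓝 (((n + 1).factorial / (-c.re / 2) ^ (n + 1)) * 0)) := by
        refine (Real.tendsto_exp_atBot.comp ?_).const_mul _
        exact tendsto_id.const_mul_atTop_of_neg (by linarith)
      rw [mul_zero] at h1
      refine squeeze_zero' (Eventually.of_forall fun _ => norm_nonneg _) ?_ h1
      filter_upwards [eventually_ge_atTop 0] with s hs using norm_pow_mul_cexp_le hc (n + 1) hs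
    have i1 := (integrableOn_pow_mul_cexp hc n).const_mul ((n : ℂ) + 1)
    have i2 := (integrableOn_pow_mul_cexp hc (n + 1)).const_mul c
    have key := integral_Ioi_of_hasDerivAt_of_tendsto' hderiv (i1.add i2) hlim
    have h0 : ((0 : ℝ) : ℂ) ^ (n + 1) * Complex.exp (c * (0 : ℝ)) = 0 := by simp
    rw [h0, integral_add i1 i2, integral_const_mul, integral_const_mul, ih, sub_zero] at key
    have hcn : (-c) ^ (n + 1) ≠ 0 := pow_ne_zero _ (neg_ne_zero.2 hc0)
    have h2 : ∫ s : ℝ in Set.Ioi 0, (s : ℂ) ^ (n + 1) * Complex.exp (c * s) =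
        ((n + 1) * (n.factorial / (-c) ^ (n + 1))) / (-c) := by
      rw [eq_div_iff (neg_ne_zero.2 hc0)]
      linear_combination -key
    rw [h2, Nat.factorial_succ]
    push_cast
    rw [pow_succ (-c) (n + 1)]
    field_simp

/-! ### The Laplace transform as a model of the Hardy space -/

/-- The exponent `2πi(ω + ih)`, whose real part is negative exactly for `ω ∈ ℍ_h`. -/
def rate (h : ℝ) (ω : ℂ) : ℂ := 2 * Real.pi * Complex.I * (ω + h * Complex.I)

theorem rate_re (h : ℝ) (ω : ℂ) : (rate h ω).re = -(2 * Real.pi * (ω.im + h)) := by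
  simp [rate]

theorem rate_re_neg {h : ℝ} {ω : ℂ} (hω : ω ∈ halfPlane h) : (rate h ω).re < 0 := by
  rw [rate_re]
  have : -h < ω.im := hω
  have := Real.pi_pos
  nlinarith

/-- The space `L²(0, ∞)` of densities. -/
abbrev Density : Type := Lp ℂ 2 ((volume : Measure ℝ).restrict (Set.Ioi 0))

/-- The space `L²(-1, 1)`. -/
abbrev IntervalL2 : Type := Lp ℂ 2 ((volume : Measure ℝ).restrict (Set.Ioo (-1) 1))

/-- The function `ω ↦ ∫₀^∞ e^{2πi s (ω + ih)} g(s) ds`. -/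
def laplace (h : ℝ) (g : Density) (ω : ℂ) : ℂ :=
  ∫ s in Set.Ioi (0 : ℝ), Complex.exp (rate h ω * s) * g s

theorem conj_rate_re_neg {h : ℝ} {a : ℂ} (ha : a ∈ halfPlane h) :
    (starRingEnd ℂ (rate h a)).re < 0 := by
  rw [Complex.conj_re]; exact rate_re_neg ha

/-- The density of the kernel `p_a`; pairing with it is evaluation of the transform at `a`. -/
def kernelVec {h : ℝ} {a : ℂ} (ha : a ∈ halfPlane h) : Density :=
  (memLp_cexp (conj_rate_re_neg ha)).toLp

theorem inner_kernelVec {h : ℝ} {a : ℂ} (ha : a ∈ halfPlane h) (g : Density) :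
    inner ℂ (kernelVec ha) g = laplace h g a := by
  rw [L2.inner_def, laplace]
  refine integral_congr_ae ?_
  filter_upwards [(memLp_cexp (conj_rate_re_neg ha)).coeFn_toLp] with s hs
  rw [kernelVec, hs, RCLike.inner_apply, ← Complex.exp_conj, mul_comm]
  simp

/-- The exponent of the product of the densities of evaluation at `ω` and of `p_a` is a multiple of
the denominator of `p_a(ω)`. -/
theorem rate_add_conj_rate (h : ℝ) (a ω : ℂ) : rate h ω + starRingEnd ℂ (rate h a) =
    2 * Real.pi * Complex.I * (ω - starRingEnd ℂ a + 2 * Complex.I * h) := by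
  simp only [rate, map_mul, map_add, Complex.conj_I, Complex.conj_ofReal, map_ofNat]
  ring

theorem rate_add_conj_rate_re_neg {h : ℝ} {a ω : ℂ} (ha : a ∈ halfPlane h) (hω : ω ∈ halfPlane h) :
    (rate h ω + starRingEnd ℂ (rate h a)).re < 0 := by
  rw [Complex.add_re]; exact add_neg (rate_re_neg hω) (conj_rate_re_neg ha)

theorem laplace_toLp_pow_mul_cexp {h : ℝ} {a ω : ℂ} (ha : a ∈ halfPlane h) (hω : ω ∈ halfPlane h)
    (n : ℕ) : laplace h (memLp_pow_mul_cexp (conj_rate_re_neg ha) n).toLp ω =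
      n.factorial / (-(rate h ω + starRingEnd ℂ (rate h a))) ^ (n + 1) := by
  rw [← integral_pow_mul_cexp (rate_add_conj_rate_re_neg ha hω), laplace]
  refine integral_congr_ae ?_
  filter_upwards [(memLp_pow_mul_cexp (conj_rate_re_neg ha) n).coeFn_toLp] with s hs
  rw [hs, add_mul, Complex.exp_add]
  ring

theorem one_div_neg_rate_eq_kernelP {h : ℝ} {a ω : ℂ}
    (hne : rate h ω + starRingEnd ℂ (rate h a) ≠ 0) :
    1 / (-(rate h ω + starRingEnd ℂ (rate h a))) = kernelP h a ω := by
  rw [kernelP]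
  rw [rate_add_conj_rate] at hne ⊢
  have hz : ω - starRingEnd ℂ a + 2 * Complex.I * h ≠ 0 := right_ne_zero_of_mul hne
  have hpi : (Real.pi : ℂ) ≠ 0 := by exact_mod_cast Real.pi_ne_zero
  field_simp
  rw [Complex.I_sq]

theorem laplace_kernelVec {h : ℝ} {a ω : ℂ} (ha : a ∈ halfPlane h) (hω : ω ∈ halfPlane h) :
    laplace h (kernelVec ha) ω = kernelP h a ω := by
  have h1 : laplace h (kernelVec ha) ω = 1 / (-(rate h ω + starRingEnd ℂ (rate h a))) := by
    have hneg := rate_add_conj_rate_re_neg ha hω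
    have := integral_pow_mul_cexp hneg 0
    simp only [pow_zero, one_mul, Nat.factorial_zero, Nat.cast_one, zero_add, pow_one] at this
    rw [← this, laplace]
    refine integral_congr_ae ?_
    filter_upwards [(memLp_cexp (conj_rate_re_neg ha)).coeFn_toLp] with s hs
    rw [kernelVec, hs, add_mul, Complex.exp_add]
  rw [h1, one_div_neg_rate_eq_kernelP fun h0 => ?_]
  have := rate_add_conj_rate_re_neg ha hω
  simp [h0] at this

theorem inner_kernelVec_kernelVec {h : ℝ} {a b : ℂ} (ha : a ∈ halfPlane h) (hb : b ∈ halfPlane h) :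
    inner ℂ (kernelVec hb) (kernelVec ha) = kernelP h a b := by
  rw [inner_kernelVec, laplace_kernelVec ha hb]

theorem conj_kernelP {h : ℝ} {a b : ℂ} (ha : a ∈ halfPlane h) (hb : b ∈ halfPlane h) :
    starRingEnd ℂ (kernelP h a b) = kernelP h b a := by
  rw [← inner_kernelVec_kernelVec ha hb, ← inner_kernelVec_kernelVec hb ha, inner_conj_symm]

theorem kernelP_self (h : ℝ) (a : ℂ) :
    kernelP h a a = ((1 / (4 * Real.pi * (a.im + h)) : ℝ) : ℂ) := by
  have h1 : a - starRingEnd ℂ a + 2 * Complex.I * h = 2 * Complex.I * ((a.im + h : ℝ) : ℂ) := by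
    rw [Complex.sub_conj]; push_cast; ring
  rw [kernelP, h1]
  push_cast
  have hpi : (Real.pi : ℂ) ≠ 0 := by exact_mod_cast Real.pi_ne_zero
  by_cases h2 : (a.im : ℂ) + h = 0
  · simp [h2]
  field_simp
  norm_num

theorem norm_kernelVec_sq {h : ℝ} {a : ℂ} (ha : a ∈ halfPlane h) :
    ‖kernelVec ha‖ ^ 2 = 1 / (4 * Real.pi * (a.im + h)) := by
  have h1 := inner_kernelVec_kernelVec ha ha
  rw [inner_self_eq_norm_sq_to_K, kernelP_self] at h1
  have h2 := congrArg Complex.re h1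
  rw [Complex.ofReal_re] at h2
  rw [← h2]
  norm_cast

theorem differentiableOn_laplace (h : ℝ) (g : Density) :
    DifferentiableOn ℂ (laplace h g) (halfPlane h) := by
  intro ω hω
  refine DifferentiableAt.differentiableWithinAt ?_
  have hω' : -h < ω.im := hω
  set d : ℝ := (ω.im + h) / 2 with hd
  have hd0 : 0 < d := by rw [hd]; linarith
  have hgm : AEStronglyMeasurable (g : ℝ → ℂ) (volume.restrict (Set.Ioi 0)) := (Lp.memLp g).1
  have hre : ∀ z ∈ Metric.ball ω d, (rate h z).re ≤ -(2 * Real.pi * d) := by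
    intro z hz
    rw [rate_re, neg_le_neg_iff]
    have h1 : |(z - ω).im| < d :=
      (Complex.abs_im_le_norm _).trans_lt (by simpa [dist_eq_norm] using hz)
    have h2 := (abs_lt.1 h1).1
    rw [Complex.sub_im] at h2
    have h3 : d ≤ z.im + h := by rw [hd] at h2 ⊢; linarith
    exact mul_le_mul_of_nonneg_left h3 (by positivity)
  have hint : Integrable (fun s : ℝ => ‖(2 * Real.pi : ℂ) * Complex.I‖ *
      ‖((s : ℂ) ^ 1 * Complex.exp ((-(2 * Real.pi * d) : ℝ) * s)) * g s‖)
      (volume.restrict (Set.Ioi 0)) := by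
    refine Integrable.const_mul ?_ _
    refine Integrable.norm ?_
    refine (memLp_pow_mul_cexp ?_ 1).integrable_mul (Lp.memLp g)
    rw [Complex.ofReal_re]
    have := Real.pi_pos
    have := mul_pos (mul_pos two_pos this) hd0
    linarith
  refine (hasDerivAt_integral_of_dominated_loc_of_deriv_le
    (F := fun z (s : ℝ) => Complex.exp (rate h z * s) * g s)
    (F' := fun z (s : ℝ) => (2 * Real.pi * Complex.I * s) * Complex.exp (rate h z * s) * g s)
    (Metric.ball_mem_nhds ω hd0) ?_ ?_ ?_ ?_ hint ?_).2.differentiableAt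
  · exact Eventually.of_forall fun z =>
      (show Continuous fun s : ℝ => Complex.exp (rate h z * s) by
        fun_prop).aestronglyMeasurable.mul hgm
  · exact (memLp_cexp (rate_re_neg hω)).integrable_mul (Lp.memLp g)
  · exact (show Continuous fun s : ℝ => (2 * Real.pi * Complex.I * s) * Complex.exp (rate h ω * s)
      by fun_prop).aestronglyMeasurable.mul hgm
  · filter_upwards [ae_restrict_mem measurableSet_Ioi] with s hs z hz
    have hs0 : 0 ≤ s := le_of_lt hs
    rw [norm_mul, norm_mul, norm_mul, norm_mul ((s : ℂ) ^ 1 * _), norm_mul ((s : ℂ) ^ 1),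
      norm_cexp_mul, norm_cexp_mul, pow_one, Complex.ofReal_re, ← mul_assoc, ← mul_assoc]
    refine mul_le_mul_of_nonneg_right (mul_le_mul_of_nonneg_left ?_ (by positivity)) (norm_nonneg _)
    exact Real.exp_le_exp.2 (mul_le_mul_of_nonneg_right (hre z hz) hs0)
  · refine Eventually.of_forall fun s z _ => ?_
    have h1 : HasDerivAt (fun z => rate h z * s) (2 * Real.pi * Complex.I * s) z := by
      have := (((hasDerivAt_id z).add_const ((h : ℂ) * Complex.I)).const_mul
        (2 * Real.pi * Complex.I)).mul_const (s : ℂ)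
      simpa [rate] using this
    have h2 := h1.cexp.mul_const (g s)
    rwa [mul_comm (Complex.exp _)] at h2

/-! ### Plancherel on horizontal lines -/

/-- The damped density `e^{-2π(y + h)s} g(s)`, extended by zero to `s ≤ 0`. -/
def dampedDensity (h : ℝ) (g : Density) (y : ℝ) : ℝ → ℂ :=
  (Set.Ioi (0 : ℝ)).indicator fun s => Complex.exp (rate h (y * Complex.I) * s) * g s

theorem mem_halfPlane_line {h y : ℝ} (hy : -h < y) (x : ℝ) :
    (x : ℂ) + y * Complex.I ∈ halfPlane h := by
  simpa [halfPlane] using hy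

theorem mul_I_mem_halfPlane {h y : ℝ} (hy : -h < y) : (y : ℂ) * Complex.I ∈ halfPlane h := by
  simpa [halfPlane] using hy

theorem laplace_line (h : ℝ) (g : Density) (x y : ℝ) :
    laplace h g (x + y * Complex.I) =
      FourierTransformInv.fourierInv (dampedDensity h g y) x := by
  rw [Real.fourierInv_eq', laplace, ← integral_indicator measurableSet_Ioi]
  congr 1
  funext s
  by_cases hs : s ∈ Set.Ioi (0 : ℝ)
  · rw [dampedDensity, Set.indicator_of_mem hs, Set.indicator_of_mem hs, smul_eq_mul, ← mul_assoc,
      ← Complex.exp_add]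
    congr 2
    simp [rate]
    ring
  · rw [dampedDensity, Set.indicator_of_notMem hs, Set.indicator_of_notMem hs, smul_zero]

theorem integrable_dampedDensity {h y : ℝ} (hy : -h < y) (g : Density) :
    Integrable (dampedDensity h g y) := by
  rw [dampedDensity, integrable_indicator_iff measurableSet_Ioi]
  exact (memLp_cexp (rate_re_neg (mul_I_mem_halfPlane hy))).integrable_mul (Lp.memLp g)

theorem aestronglyMeasurable_damped (h y : ℝ) (g : Density) : AEStronglyMeasurable
    (fun s : ℝ => Complex.exp (rate h (y * Complex.I) * s) * g s)
    (volume.restrict (Set.Ioi 0)) :=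
  (show Continuous fun s : ℝ => Complex.exp (rate h (y * Complex.I) * s) by
    fun_prop).aestronglyMeasurable.mul (Lp.memLp g).1

theorem norm_damped_le {h y : ℝ} (hy : -h < y) (g : Density) {s : ℝ} (hs : s ∈ Set.Ioi (0 : ℝ)) :
    ‖Complex.exp (rate h (y * Complex.I) * s) * g s‖ ≤ ‖g s‖ := by
  rw [norm_mul, norm_cexp_mul]
  refine mul_le_of_le_one_left (norm_nonneg _) (Real.exp_le_one_iff.2 ?_)
  exact mul_nonpos_of_nonpos_of_nonneg (rate_re_neg (mul_I_mem_halfPlane hy)).le (le_of_lt hs)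

theorem memLp_dampedDensity {h y : ℝ} (hy : -h < y) (g : Density) :
    MemLp (dampedDensity h g y) 2 := by
  rw [dampedDensity, memLp_indicator_iff_restrict measurableSet_Ioi]
  refine (Lp.memLp g).mono (aestronglyMeasurable_damped h y g) ?_
  filter_upwards [ae_restrict_mem measurableSet_Ioi] with s hs using norm_damped_le hy g hs

theorem eLpNorm_laplace_line {h y : ℝ} (hy : -h < y) (g : Density) :
    eLpNorm (fun x : ℝ => laplace h g (x + y * Complex.I)) 2 volume =
      eLpNorm (fun s : ℝ => Complex.exp (rate h (y * Complex.I) * s) * g s) 2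
        (volume.restrict (Set.Ioi 0)) := by
  simp only [laplace_line]
  rw [show (fun x => FourierTransformInv.fourierInv (dampedDensity h g y) x) =
    FourierTransformInv.fourierInv (dampedDensity h g y) from rfl,
    eLpNorm_fourierInv (integrable_dampedDensity hy g) (memLp_dampedDensity hy g), dampedDensity,
    eLpNorm_indicator_eq_eLpNorm_restrict measurableSet_Ioi]

/-- The Paley-Wiener isometry: the Hardy norm of the transform is the norm of the density. -/
theorem hardyNorm_laplace (h : ℝ) (g : Density) : hardyNorm h (laplace h g) = ‖g‖ₑ := by
  rw [Lp.enorm_def]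
  refine le_antisymm (iSup₂_le fun y hy => ?_) ?_
  · rw [eLpNorm_laplace_line hy]
    refine eLpNorm_mono_ae ?_
    filter_upwards [ae_restrict_mem measurableSet_Ioi] with s hs using norm_damped_le hy g hs
  · have hy : ∀ n : ℕ, -h < -h + 1 / ((n : ℝ) + 1) := fun n =>
      lt_add_of_pos_right _ (by positivity)
    refine (Lp.eLpNorm_lim_le_liminf_eLpNorm
      (fun n : ℕ => aestronglyMeasurable_damped h (-h + 1 / ((n : ℝ) + 1)) g) g ?_).trans ?_
    · refine Eventually.of_forall fun s => ?_
      have hc : Continuous fun y : ℝ => Complex.exp (rate h (y * Complex.I) * s) * g s := by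
        unfold rate; fun_prop
      have h1 : Tendsto (fun n : ℕ => -h + 1 / ((n : ℝ) + 1)) atTop (𝓝 (-h + 0)) :=
        tendsto_const_nhds.add tendsto_one_div_add_atTop_nhds_zero_nat
      have h2 := (hc.tendsto _).comp h1
      have h3 : Complex.exp (rate h (((-h + 0 : ℝ) : ℂ) * Complex.I) * s) * g s = g s := by
        simp [rate]
      rw [h3] at h2
      exact h2
    -- the lines approach the boundary, and the damping disappears in the limit
    · refine liminf_le_of_le (by isBoundedDefault) fun b hb => ?_
      obtain ⟨n, hn⟩ := hb.exists
      refine hn.trans ?_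
      rw [← eLpNorm_laplace_line (hy n)]
      exact le_iSup₂ (f := fun (y : ℝ) (_ : -h < y) =>
        eLpNorm (fun x : ℝ => laplace h g (x + y * Complex.I)) 2 volume) _ (hy n)

theorem memH2_laplace (h : ℝ) (g : Density) : MemH2 h (laplace h g) :=
  ⟨differentiableOn_laplace h g, by rw [hardyNorm_laplace]; exact enorm_lt_top⟩

/-! ### Restriction to the interval -/

theorem ofReal_mem_halfPlane {h : ℝ} (hh : 0 < h) (x : ℝ) : (x : ℂ) ∈ halfPlane h := by
  simpa [halfPlane] using hh

theorem isOpen_halfPlane (h : ℝ) : IsOpen (halfPlane h) :=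
  isOpen_lt continuous_const Complex.continuous_im

theorem continuous_comp_ofReal {h : ℝ} (hh : 0 < h) {f : ℂ → ℂ}
    (hf : DifferentiableOn ℂ f (halfPlane h)) : Continuous fun x : ℝ => f x :=
  hf.continuousOn.comp_continuous Complex.continuous_ofReal (ofReal_mem_halfPlane hh)

theorem memLp_interval_of_continuous {f : ℝ → ℂ} (hf : Continuous f) :
    MemLp f 2 ((volume : Measure ℝ).restrict (Set.Ioo (-1) 1)) := by
  obtain ⟨C, hC⟩ := (isCompact_Icc (a := (-1 : ℝ)) (b := 1)).exists_bound_of_continuousOn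
    hf.continuousOn
  refine MemLp.of_bound hf.aestronglyMeasurable C ?_
  filter_upwards [ae_restrict_mem measurableSet_Ioo] with x hx using
    hC x (Set.Ioo_subset_Icc_self hx)

/-- The restriction to `(-1, 1)` of a function analytic in `ℍ_h`, as an element of `L²(-1, 1)`. -/
def intervalRestrict {h : ℝ} (hh : 0 < h) {f : ℂ → ℂ} (hf : DifferentiableOn ℂ f (halfPlane h)) :
    IntervalL2 := (memLp_interval_of_continuous (continuous_comp_ofReal hh hf)).toLp

theorem intervalRestrict_ae {h : ℝ} (hh : 0 < h) {f : ℂ → ℂ}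
    (hf : DifferentiableOn ℂ f (halfPlane h)) :
    intervalRestrict hh hf =ᵐ[volume.restrict (Set.Ioo (-1) 1)] fun x : ℝ => f x :=
  MemLp.coeFn_toLp _

theorem enorm_intervalRestrict {h : ℝ} (hh : 0 < h) {f : ℂ → ℂ}
    (hf : DifferentiableOn ℂ f (halfPlane h)) : ‖intervalRestrict hh hf‖ₑ = intervalNorm f :=
  Lp.enorm_toLp _

theorem intervalNorm_le_hardyNorm {h : ℝ} (hh : 0 < h) (f : ℂ → ℂ) :
    intervalNorm f ≤ hardyNorm h f := by
  have h1 : intervalNorm f ≤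
      eLpNorm (fun x : ℝ => f (x + (0 : ℝ) * Complex.I)) 2 volume := by
    simp only [Complex.ofReal_zero, zero_mul, add_zero]
    exact eLpNorm_restrict_le _ _ _ _
  exact h1.trans (le_iSup₂ (f := fun (y : ℝ) (_ : -h < y) =>
        eLpNorm (fun x : ℝ => f (x + y * Complex.I)) 2 volume) 0 (by linarith))

theorem laplace_add {h : ℝ} {ω : ℂ} (hω : ω ∈ halfPlane h) (f g : Density) :
    laplace h (f + g) ω = laplace h f ω + laplace h g ω := by
  simp only [← inner_kernelVec hω, inner_add_right]

theorem laplace_smul {h : ℝ} {ω : ℂ} (hω : ω ∈ halfPlane h) (c : ℂ) (g : Density) :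
    laplace h (c • g) ω = c * laplace h g ω := by
  simp only [← inner_kernelVec hω, inner_smul_right]

theorem enorm_intervalRestrict_laplace_le {h : ℝ} (hh : 0 < h) (g : Density) :
    ‖intervalRestrict hh (differentiableOn_laplace h g)‖ₑ ≤ ‖g‖ₑ := by
  rw [enorm_intervalRestrict, ← hardyNorm_laplace h]
  exact intervalNorm_le_hardyNorm hh _

/-- The restriction operator from densities to `L²(-1, 1)`, through the Laplace transform. -/
def restrictOp {h : ℝ} (hh : 0 < h) : Density →L[ℂ] IntervalL2 :=
  LinearMap.mkContinuous
    { toFun := fun g => intervalRestrict hh (differentiableOn_laplace h g)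
      map_add' := fun f g => by
        refine Lp.ext ?_
        filter_upwards [intervalRestrict_ae hh (differentiableOn_laplace h (f + g)),
          intervalRestrict_ae hh (differentiableOn_laplace h f),
          intervalRestrict_ae hh (differentiableOn_laplace h g),
          Lp.coeFn_add (intervalRestrict hh (differentiableOn_laplace h f))
            (intervalRestrict hh (differentiableOn_laplace h g))] with x h1 h2 h3 h4
        rw [h1, h4, Pi.add_apply, h2, h3, laplace_add (ofReal_mem_halfPlane hh x)]
      map_smul' := fun c g => by
        refine Lp.ext ?_
        filter_upwards [intervalRestrict_ae hh (differentiableOn_laplace h (c • g)),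
          intervalRestrict_ae hh (differentiableOn_laplace h g),
          Lp.coeFn_smul c (intervalRestrict hh (differentiableOn_laplace h g))] with x h1 h2 h3
        rw [h1, RingHom.id_apply, h3, Pi.smul_apply, h2, laplace_smul (ofReal_mem_halfPlane hh x),
          smul_eq_mul] } 1 fun g => by
    rw [one_mul]
    exact (enorm_le_iff_norm_le).1 (enorm_intervalRestrict_laplace_le hh g)

theorem restrictOp_apply {h : ℝ} (hh : 0 < h) (g : Density) :
    restrictOp hh g = intervalRestrict hh (differentiableOn_laplace h g) := rfl

theorem enorm_restrictOp {h : ℝ} (hh : 0 < h) (g : Density) :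
    ‖restrictOp hh g‖ₑ = intervalNorm (laplace h g) := by
  rw [restrictOp_apply, enorm_intervalRestrict]

/-- The adjoint of the restriction superposes the kernels `p_x`, `-1 < x < 1`. -/
theorem laplace_adjoint {h : ℝ} (hh : 0 < h) {ω : ℂ} (hω : ω ∈ halfPlane h) (v : IntervalL2) :
    laplace h ((restrictOp hh).adjoint v) ω =
      ∫ x in Set.Ioo (-1 : ℝ) 1, kernelP h (x : ℂ) ω * v x := by
  rw [← inner_kernelVec hω, ContinuousLinearMap.adjoint_inner_right, L2.inner_def]
  refine integral_congr_ae ?_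
  filter_upwards [intervalRestrict_ae hh (differentiableOn_laplace h (kernelVec hω))] with x hx
  rw [restrictOp_apply, hx, laplace_kernelVec hω (ofReal_mem_halfPlane hh x), RCLike.inner_apply,
    conj_kernelP hω (ofReal_mem_halfPlane hh x), mul_comm]

/-- The operator `𝒦` is `R†` after restriction to the interval. -/
theorem laplace_adjoint_intervalRestrict {h : ℝ} (hh : 0 < h) {ω : ℂ} (hω : ω ∈ halfPlane h)
    {f : ℂ → ℂ} (hf : DifferentiableOn ℂ f (halfPlane h)) :
    laplace h ((restrictOp hh).adjoint (intervalRestrict hh hf)) ω = opK h f ω := by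
  rw [laplace_adjoint hh hω, opK, intervalIntegral.integral_of_le (by norm_num),
    integral_Ioc_eq_integral_Ioo]
  refine integral_congr_ae ?_
  filter_upwards [intervalRestrict_ae hh hf] with x hx
  rw [hx]

theorem kernelP_ne_zero {h : ℝ} {a ω : ℂ} (ha : a ∈ halfPlane h) (hω : ω ∈ halfPlane h) :
    kernelP h a ω ≠ 0 := by
  have hne : rate h ω + starRingEnd ℂ (rate h a) ≠ 0 := fun h0 => by
    have := rate_add_conj_rate_re_neg ha hω
    rw [h0] at this; simp at this
  rw [rate_add_conj_rate] at hne
  rw [kernelP]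
  refine div_ne_zero Complex.I_ne_zero (mul_ne_zero ?_ (right_ne_zero_of_mul hne))
  exact mul_ne_zero two_ne_zero (by exact_mod_cast Real.pi_ne_zero)

theorem restrictOp_kernelVec_ne_zero {h : ℝ} (hh : 0 < h) {a : ℂ} (ha : a ∈ halfPlane h) :
    restrictOp hh (kernelVec ha) ≠ 0 := by
  intro h0
  have h1 := intervalRestrict_ae hh (differentiableOn_laplace h (kernelVec ha))
  rw [← restrictOp_apply, h0] at h1
  have h2 : ∀ᵐ x ∂(volume : Measure ℝ).restrict (Set.Ioo (-1) 1), False := by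
    filter_upwards [h1, Lp.coeFn_zero ℂ 2 ((volume : Measure ℝ).restrict (Set.Ioo (-1) 1))]
      with x hx hx0
    rw [hx0, laplace_kernelVec ha (ofReal_mem_halfPlane hh x)] at hx
    exact kernelP_ne_zero ha (ofReal_mem_halfPlane hh x) hx.symm
  rw [ae_iff] at h2
  norm_num at h2

theorem norm_restrictOp_le {h : ℝ} (hh : 0 < h) (g : Density) {C : ℝ} (hC : 0 ≤ C)
    (hg : ∀ x ∈ Set.Ioo (-1 : ℝ) 1, ‖laplace h g x‖ ≤ C) : ‖restrictOp hh g‖ ≤ 2 * C := by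
  have h1 := Lp.norm_le_of_ae_bound (p := 2) (f := restrictOp hh g) hC (by
    filter_upwards [intervalRestrict_ae hh (differentiableOn_laplace h g),
      ae_restrict_mem measurableSet_Ioo] with x hx hxm
    rw [restrictOp_apply, hx]; exact hg x hxm)
  refine h1.trans (mul_le_mul_of_nonneg_right ?_ hC)
  have h2 : (measureUnivNNReal ((volume : Measure ℝ).restrict (Set.Ioo (-1) 1)) : ℝ) = 2 := by
    simp [measureUnivNNReal]; norm_num
    exact ENNReal.toReal_ofNat 2
  rw [h2]
  calc (2 : ℝ) ^ ((2 : ℝ≥0∞).toReal⁻¹) ≤ 2 ^ (1 : ℝ) :=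
        Real.rpow_le_rpow_of_exponent_le (by norm_num) (by norm_num)
    _ = 2 := Real.rpow_one 2

theorem norm_restrictOp_kernelVec_lt {h ω₀ : ℝ} (hh : 0 < h) :
    ‖restrictOp hh (kernelVec (ofReal_mem_halfPlane hh ω₀))‖ <
      ‖kernelVec (ofReal_mem_halfPlane hh ω₀)‖ := by
  -- on the real line the kernel has the norm of the kernel at the shifted point `ω₀ + ih`
  have hb : (ω₀ : ℂ) + h * Complex.I ∈ halfPlane h := mem_halfPlane_line (by linarith) ω₀
  set p := kernelVec (ofReal_mem_halfPlane hh ω₀) with hp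
  have h1 : ‖restrictOp hh p‖ ≤ ‖kernelVec hb‖ := by
    rw [← enorm_le_iff_norm_le, enorm_restrictOp]
    have e1 : intervalNorm (laplace h p) ≤
        eLpNorm (fun x : ℝ => laplace h p (x + (0 : ℝ) * Complex.I)) 2 volume := by
      simp only [Complex.ofReal_zero, zero_mul, add_zero]
      exact eLpNorm_restrict_le _ _ _ _
    refine e1.trans ?_
    rw [eLpNorm_laplace_line (by linarith), Lp.enorm_def]
    refine le_of_eq (eLpNorm_congr_norm_ae ?_)
    filter_upwards [(memLp_cexp (conj_rate_re_neg (ofReal_mem_halfPlane hh ω₀))).coeFn_toLp,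
      (memLp_cexp (conj_rate_re_neg hb)).coeFn_toLp] with s hs1 hs2
    rw [hp, kernelVec, kernelVec, hs1, hs2, norm_mul, norm_cexp_mul, norm_cexp_mul, norm_cexp_mul,
      ← Real.exp_add]
    congr 1
    simp only [Complex.conj_re, rate_re]
    simp
    ring
  refine h1.trans_lt (lt_of_pow_lt_pow_left₀ 2 (norm_nonneg _) ?_)
  rw [norm_kernelVec_sq, hp, norm_kernelVec_sq]
  simp only [Complex.add_im, Complex.ofReal_im, Complex.mul_im, Complex.ofReal_re, Complex.I_im,
    Complex.I_re, mul_one, mul_zero, add_zero, zero_add]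
  have := Real.pi_pos
  exact one_div_lt_one_div_of_lt (by positivity) (by nlinarith [mul_pos this hh])

/-- Powers of `2ih / (ω - ω₀ + 2ih)` are functions with value `1` at `ω₀` and arbitrarily small
norm on the interval. -/
theorem exists_small_on_interval {h ω₀ : ℝ} (hh : 0 < h) (hω₀ : 1 < ω₀) :
    ∀ δ > 0, ∃ f : Density, inner ℂ (kernelVec (ofReal_mem_halfPlane hh ω₀)) f = 1 ∧
      ‖restrictOp hh f‖ < δ := by
  intro δ hδ
  have ha := ofReal_mem_halfPlane hh ω₀
  set A : ℂ → ℂ := fun ω => -(rate h ω + starRingEnd ℂ (rate h ω₀)) with hA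
  have hA0 : A ω₀ = ((4 * Real.pi * h : ℝ) : ℂ) := by
    simp only [hA, rate_add_conj_rate, Complex.conj_ofReal, sub_self, zero_add]
    push_cast
    linear_combination (-4 * (Real.pi : ℂ) * h) * Complex.I_sq
  set B : ℝ := 2 * Real.pi * Real.sqrt ((ω₀ - 1) ^ 2 + (2 * h) ^ 2) with hB
  have hpi := Real.pi_pos
  have hB0 : 4 * Real.pi * h < B := by
    have : 2 * h < Real.sqrt ((ω₀ - 1) ^ 2 + (2 * h) ^ 2) :=
      Real.lt_sqrt_of_sq_lt (by nlinarith [sub_pos.2 hω₀])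
    rw [hB]; nlinarith
  have hBpos : 0 < B := lt_trans (by positivity) hB0
  have hAx : ∀ x ∈ Set.Ioo (-1 : ℝ) 1, B ≤ ‖A x‖ := by
    intro x hx
    have e1 : ‖A x‖ = 2 * Real.pi * ‖((x - ω₀ : ℝ) : ℂ) + ((2 * h : ℝ) : ℂ) * Complex.I‖ := by
      simp only [hA, norm_neg, rate_add_conj_rate, Complex.conj_ofReal, norm_mul, Complex.norm_I,
        Complex.norm_real, Real.norm_of_nonneg hpi.le, mul_one, Complex.norm_ofNat]
      congr 2
      push_cast; ring
    rw [e1, Complex.norm_add_mul_I, hB]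
    refine mul_le_mul_of_nonneg_left (Real.sqrt_le_sqrt ?_) (by positivity)
    nlinarith [hx.2]
  set q : ℝ := 4 * Real.pi * h / B with hq
  have hq0 : 0 ≤ q := by rw [hq]; positivity
  have hq1 : q < 1 := (div_lt_one hBpos).2 hB0
  obtain ⟨n, hn⟩ := exists_pow_lt_of_lt_one (show (0 : ℝ) < δ / 2 by positivity) hq1
  set c : ℂ := (((4 * Real.pi * h : ℝ) : ℂ)) ^ (n + 1) / n.factorial with hc
  have hfac : (n.factorial : ℂ) ≠ 0 := by exact_mod_cast n.factorial_ne_zero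
  have h4 : ((4 * Real.pi * h : ℝ) : ℂ) ≠ 0 := by
    exact_mod_cast (show (4 * Real.pi * h : ℝ) ≠ 0 by positivity)
  have hval : ∀ ω ∈ halfPlane h,
      laplace h (c • (memLp_pow_mul_cexp (conj_rate_re_neg ha) n).toLp) ω =
        (((4 * Real.pi * h : ℝ) : ℂ) / A ω) ^ (n + 1) := by
    intro ω hω
    rw [laplace_smul hω, laplace_toLp_pow_mul_cexp ha hω, hc, div_pow]
    field_simp
    rfl
  refine ⟨c • (memLp_pow_mul_cexp (conj_rate_re_neg ha) n).toLp, ?_, ?_⟩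
  · rw [inner_kernelVec, hval _ ha, hA0, div_self h4, one_pow]
  · have h5 : ‖restrictOp hh (c • (memLp_pow_mul_cexp (conj_rate_re_neg ha) n).toLp)‖ ≤
        2 * q ^ (n + 1) := by
      refine norm_restrictOp_le hh _ (by positivity) fun x hx => ?_
      rw [hval _ (ofReal_mem_halfPlane hh x), norm_pow, norm_div, Complex.norm_real,
        Real.norm_of_nonneg (by positivity), hq]
      exact pow_le_pow_left₀ (by positivity)
        (div_le_div_of_nonneg_left (by positivity) hBpos (hAx x hx)) _
    have h6 : q ^ (n + 1) ≤ q ^ n := pow_le_pow_of_le_one hq0 hq1.le (Nat.le_succ n)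
    linarith

/-! ### Cauchy's formula on a boundary line -/

/-- The `L²` norm of `1 / (x - r + id)`, read off from the norm of the kernel of the half-plane
`Im z > -|d| / 2`. -/
theorem eLpNorm_inv_line_le (r : ℝ) {d : ℝ} (hd : d ≠ 0) :
    eLpNorm (fun x : ℝ => (((x - r : ℝ) : ℂ) + d * Complex.I)⁻¹) 2 volume ≤
      ENNReal.ofReal (2 * Real.pi * Real.sqrt (1 / (2 * Real.pi * |d|))) := by
  have hpi := Real.pi_pos
  have hd0 : 0 < |d| := abs_pos.2 hd
  have hH : 0 < |d| / 2 := by positivity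
  have hr := ofReal_mem_halfPlane hH r
  have h1 : eLpNorm (fun x : ℝ => kernelP (|d| / 2) r x) 2 volume ≤ ‖kernelVec hr‖ₑ := by
    rw [← hardyNorm_laplace]
    refine le_trans (le_of_eq ?_) (le_iSup₂ (f := fun (y : ℝ) (_ : -(|d| / 2) < y) =>
        eLpNorm (fun x : ℝ => laplace (|d| / 2) (kernelVec hr) (x + y * Complex.I)) 2 volume)
        0 (by linarith))
    congr 1
    funext x
    rw [Complex.ofReal_zero, zero_mul, add_zero, laplace_kernelVec hr (ofReal_mem_halfPlane hH x)]
  have h2 : eLpNorm (fun x : ℝ => (((x - r : ℝ) : ℂ) + d * Complex.I)⁻¹) 2 volume =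
      eLpNorm ((2 * Real.pi) • fun x : ℝ => kernelP (|d| / 2) r x) 2 volume := by
    refine eLpNorm_congr_norm_ae (Eventually.of_forall fun x => ?_)
    have e1 : (x : ℂ) - starRingEnd ℂ (r : ℂ) + 2 * Complex.I * ((|d| / 2 : ℝ) : ℂ) =
        ((x - r : ℝ) : ℂ) + ((|d| : ℝ) : ℂ) * Complex.I := by
      rw [Complex.conj_ofReal]; push_cast; ring
    rw [Pi.smul_apply, norm_smul, kernelP, e1, norm_div, norm_mul (2 * (Real.pi : ℂ)),
      Complex.norm_I, norm_inv, Complex.norm_add_mul_I, Complex.norm_add_mul_I, sq_abs,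
      norm_mul, norm_mul,
      Complex.norm_ofNat, Complex.norm_real, Real.norm_ofNat, Real.norm_of_nonneg hpi.le]
    field_simp
  have h3 : ‖kernelVec hr‖ = Real.sqrt (1 / (2 * Real.pi * |d|)) := by
    rw [← Real.sqrt_sq (norm_nonneg (kernelVec hr)), norm_kernelVec_sq, Complex.ofReal_im]
    congr 2; ring
  rw [h2, eLpNorm_const_smul, ENNReal.ofReal_mul (by positivity), ← h3, ofReal_norm,
    ← Real.enorm_eq_ofReal (by positivity)]
  gcongr

/-- If the side integrals are dominated by an integrable function, the integrals of an analytic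
function over two horizontal lines agree. -/
theorem integral_line_eq_integral_line {G : ℂ → ℂ} {y₁ y₂ : ℝ} (hy : y₁ ≤ y₂)
    (hG : DifferentiableOn ℂ G {z | y₁ ≤ z.im})
    (i₁ : Integrable fun x : ℝ => G (x + y₁ * Complex.I))
    (i₂ : Integrable fun x : ℝ => G (x + y₂ * Complex.I))
    {m : ℝ → ℝ≥0∞} (hm : Measurable m) (hmi : ∫⁻ x, m x ≠ ∞) {X₀ : ℝ}
    (hS : ∀ x : ℝ, X₀ ≤ |x| → ∫⁻ y in Set.Ioc y₁ y₂, ‖G (x + y * Complex.I)‖ₑ ≤ m x) :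
    ∫ x : ℝ, G (x + y₁ * Complex.I) = ∫ x : ℝ, G (x + y₂ * Complex.I) := by
  set S : ℝ → ℂ := fun X => (∫ y in y₁..y₂, G ((-X : ℝ) + y * Complex.I)) -
    ∫ y in y₁..y₂, G ((X : ℝ) + y * Complex.I) with hSdef
  have hrect : ∀ X : ℝ, (∫ x in (-X)..X, G (x + y₁ * Complex.I)) -
      (∫ x in (-X)..X, G (x + y₂ * Complex.I)) = Complex.I * S X := by
    intro X
    have := Complex.integral_boundary_rect_eq_zero_of_differentiableOn G
      (((-X : ℝ) : ℂ) + y₁ * Complex.I) (((X : ℝ) : ℂ) + y₂ * Complex.I) (hG.mono ?_)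
    · simp only [Complex.add_re, Complex.ofReal_re, Complex.mul_re, Complex.I_re, mul_zero,
        Complex.ofReal_im, Complex.I_im, mul_one, sub_self, add_zero, Complex.add_im,
        Complex.mul_im, zero_add, smul_eq_mul] at this
      rw [hSdef]
      linear_combination this
    · intro z hz
      have hz2 := hz.2
      simp only [Complex.add_im, Complex.ofReal_im, Complex.mul_im, Complex.ofReal_re,
        Complex.I_im, Complex.I_re, mul_one, mul_zero, add_zero, zero_add, Set.mem_preimage,
        Set.uIcc_of_le hy] at hz2
      exact hz2.1
  have hlim : Tendsto (fun X : ℝ => Complex.I * S X) atTop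
      (𝓝 ((∫ x : ℝ, G (x + y₁ * Complex.I)) - ∫ x : ℝ, G (x + y₂ * Complex.I))) := by
    have t1 := intervalIntegral_tendsto_integral i₁ tendsto_neg_atTop_atBot tendsto_id
    have t2 := intervalIntegral_tendsto_integral i₂ tendsto_neg_atTop_atBot tendsto_id
    exact (t1.sub t2).congr hrect
  -- otherwise the side integrals stay away from zero, against integrability of the majorant
  by_contra hne
  set J := (∫ x : ℝ, G (x + y₁ * Complex.I)) - ∫ x : ℝ, G (x + y₂ * Complex.I) with hJ
  have hJ0 : 0 < ‖J‖ₑ := by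
    rw [enorm_pos]; exact sub_ne_zero.2 hne
  obtain ⟨c, hc0, hcJ⟩ := exists_between hJ0
  have hside : ∀ x : ℝ, X₀ ≤ |x| → ‖∫ y in y₁..y₂, G (x + y * Complex.I)‖ₑ ≤ m x := by
    intro x hx
    rw [intervalIntegral.integral_of_le hy]
    exact (enorm_integral_le_lintegral_enorm _).trans (hS x hx)
  have hev : ∀ᶠ X : ℝ in atTop, c ≤ m X + m (-X) := by
    filter_upwards [hlim.enorm.eventually (lt_mem_nhds hcJ), eventually_ge_atTop X₀] with X h1 h2
    refine h1.le.trans ?_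
    rw [enorm_mul, show ‖Complex.I‖ₑ = 1 by simp [enorm_eq_nnnorm], one_mul, hSdef]
    refine (enorm_sub_le).trans ?_
    rw [add_comm]
    exact add_le_add (hside X (h2.trans (le_abs_self X)))
      (hside (-X) (h2.trans (by rw [abs_neg]; exact le_abs_self X)))
  obtain ⟨X₁, hX₁⟩ := eventually_atTop.1 hev
  have hinf : ∫⁻ X in Set.Ici X₁, c ≤ ∫⁻ X, m X + m (-X) :=
    (setLIntegral_mono (hm.add (hm.comp measurable_neg)) fun X hX => hX₁ X hX).trans
      (setLIntegral_le_lintegral _ _)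
  rw [lintegral_add_left hm, lintegral_neg_eq_self m, setLIntegral_const, Real.volume_Ici,
    ENNReal.mul_top hc0.ne', top_le_iff, ENNReal.add_eq_top, or_self] at hinf
  exact hmi hinf

/-- Cauchy's formula for a function of Hardy class, analytic up to the line `Im z = -h`, at a zero
of the function. -/
theorem integral_line_div_eq_zero {h : ℝ} {F : ℂ → ℂ} {N : ℝ≥0∞} (hN : N ≠ ∞)
    (hF : DifferentiableOn ℂ F {z | -h ≤ z.im})
    (hFN : ∀ y : ℝ, -h ≤ y → eLpNorm (fun x : ℝ => F (x + y * Complex.I)) 2 volume ≤ N)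
    {a : ℂ} (ha : a ∈ halfPlane h) (hFa : F a = 0) :
    ∫ x : ℝ, F (x + (-h : ℝ) * Complex.I) * (x + (-h : ℝ) * Complex.I - a)⁻¹ = 0 := by
  have ha' : -h < a.im := ha
  have hnhds : {z : ℂ | -h ≤ z.im} ∈ 𝓝 a :=
    mem_of_superset ((isOpen_halfPlane h).mem_nhds ha) fun z (hz : -h < z.im) => hz.le
  set G := dslope F a with hGdef
  have hG : DifferentiableOn ℂ G {z | -h ≤ z.im} := (Complex.differentiableOn_dslope hnhds).2 hF
  have hGval : ∀ z, z ≠ a → G z = F z * (z - a)⁻¹ := by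
    intro z hz
    rw [hGdef, dslope_of_ne _ hz, slope_def_field, hFa, sub_zero, div_eq_mul_inv]
  have hline : ∀ x y : ℝ, (x : ℂ) + y * Complex.I - a =
      ((x - a.re : ℝ) : ℂ) + ((y - a.im : ℝ) : ℂ) * Complex.I := by
    intro x y
    apply Complex.ext <;> simp
  have hcont : ∀ y : ℝ, -h ≤ y → Continuous fun x : ℝ => F (x + y * Complex.I) := by
    intro y hy
    refine hF.continuousOn.comp_continuous (by fun_prop) fun x => ?_
    simpa using hy
  have hmem : ∀ y : ℝ, -h ≤ y → MemLp (fun x : ℝ => F (x + y * Complex.I)) 2 volume := fun y hy =>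
    ⟨(hcont y hy).aestronglyMeasurable, (hFN y hy).trans_lt hN.lt_top⟩
  have hmemk : ∀ y : ℝ, y ≠ a.im →
      MemLp (fun x : ℝ => ((x : ℂ) + y * Complex.I - a)⁻¹) 2 volume := by
    intro y hy
    simp only [hline]
    refine ⟨(Measurable.inv (by fun_prop)).aestronglyMeasurable,
      (eLpNorm_inv_line_le a.re (sub_ne_zero.2 hy)).trans_lt ENNReal.ofReal_lt_top⟩
  have hGline : ∀ y : ℝ, y ≠ a.im → (fun x : ℝ => G (x + y * Complex.I)) =
      fun x : ℝ => F (x + y * Complex.I) * ((x : ℂ) + y * Complex.I - a)⁻¹ := by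
    intro y hy
    funext x
    refine hGval _ fun he => hy ?_
    rw [← he]; simp
  have hGint : ∀ y : ℝ, -h ≤ y → y ≠ a.im → Integrable fun x : ℝ => G (x + y * Complex.I) := by
    intro y hy hya
    rw [hGline y hya]
    exact (hmem y hy).integrable_mul (hmemk y hya)
  have hGbound : ∀ y : ℝ, -h ≤ y → y ≠ a.im → ‖∫ x : ℝ, G (x + y * Complex.I)‖ₑ ≤
      N * ENNReal.ofReal (2 * Real.pi * Real.sqrt (1 / (2 * Real.pi * |y - a.im|))) := by
    intro y hy hya
    refine (enorm_integral_le_lintegral_enorm _).trans ?_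
    rw [← eLpNorm_one_eq_lintegral_enorm, hGline y hya]
    have h1 := eLpNorm_smul_le_mul_eLpNorm (p := 2) (q := 2) (r := 1) (μ := volume)
      (hmemk y hya).1 (hmem y hy).1
    refine le_trans h1 (mul_le_mul' (hFN y hy) ?_)
    simp only [hline]
    exact eLpNorm_inv_line_le a.re (sub_ne_zero.2 hya)
  -- the line integral does not depend on the height of the line above `a`
  have hshift : ∀ Y : ℝ, a.im < Y → ∫ x : ℝ, G (x + (-h : ℝ) * Complex.I) =
      ∫ x : ℝ, G (x + Y * Complex.I) := by
    intro Y hY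
    classical
    have hhY : -h ≤ Y := (ha'.trans hY).le
    -- the extension by zero is measurable on the whole plane
    set F' : ℂ → ℂ := Set.piecewise {z : ℂ | -h ≤ z.im} F 0 with hF'
    have hF'm : Measurable F' := by
      refine ContinuousOn.measurable_piecewise hF.continuousOn continuousOn_const ?_
      exact (isClosed_le continuous_const Complex.continuous_im).measurableSet
    have hF'val : ∀ x y : ℝ, -h ≤ y → F' (x + y * Complex.I) = F (x + y * Complex.I) := by
      intro x y hy
      exact Set.piecewise_eq_of_mem _ _ _ (by simpa using hy)
    -- away from the pole `|G| ≤ |F|² + 2|κ|²`, which is integrable over the strip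
    set κ : ℝ → ℂ := fun x => (((x - a.re : ℝ) : ℂ) + ((1 : ℝ) : ℂ) * Complex.I)⁻¹ with hκ
    have hκm : Measurable κ := Measurable.inv (by fun_prop)
    set m : ℝ → ℝ≥0∞ := fun x => (∫⁻ y in Set.Ioc (-h) Y, ‖F' (x + y * Complex.I)‖ₑ ^ 2) +
      2 * ENNReal.ofReal (Y + h) * ‖κ x‖ₑ ^ 2 with hm
    have hmm1 : Measurable fun p : ℝ × ℝ => ‖F' (p.1 + p.2 * Complex.I)‖ₑ ^ 2 := by
      refine Measurable.pow_const (Measurable.enorm (hF'm.comp ?_)) 2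
      fun_prop
    have hmm : Measurable m := by
      refine Measurable.add ?_ ?_
      · exact Measurable.lintegral_prod_right' (ν := volume.restrict (Set.Ioc (-h) Y)) hmm1
      · exact (hκm.enorm.pow_const 2).const_mul _
    have hsq : ∀ φ : ℝ → ℂ, ∫⁻ x, ‖φ x‖ₑ ^ 2 = eLpNorm φ 2 volume ^ 2 := by
      intro φ
      have := eLpNorm_nnreal_pow_eq_lintegral (p := 2) (f := φ) (μ := volume) (by norm_num)
      simpa using this.symm
    have hmi : ∫⁻ x, m x ≠ ∞ := by
      rw [hm, lintegral_add_right _ ((hκm.enorm.pow_const 2).const_mul _),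
        lintegral_const_mul _ (hκm.enorm.pow_const 2), hsq]
      refine ENNReal.add_ne_top.2 ⟨?_, ?_⟩
      · rw [lintegral_lintegral_swap hmm1.aemeasurable]
        have : ∫⁻ y in Set.Ioc (-h) Y, ∫⁻ x : ℝ, ‖F' (x + y * Complex.I)‖ₑ ^ 2 ≤
            ∫⁻ y in Set.Ioc (-h) Y, N ^ 2 := by
          refine setLIntegral_mono measurable_const fun y hy => ?_
          simp only [fun x : ℝ => hF'val x y hy.1.le]
          rw [hsq]
          gcongr
          exact hFN y hy.1.le
        refine ne_top_of_le_ne_top ?_ this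
        rw [setLIntegral_const]
        exact ENNReal.mul_ne_top (ENNReal.pow_ne_top hN) (by simp)
      · refine ENNReal.mul_ne_top (ENNReal.mul_ne_top (by norm_num) ENNReal.ofReal_ne_top)
          (ENNReal.pow_ne_top ?_)
        exact ((eLpNorm_inv_line_le a.re one_ne_zero).trans_lt ENNReal.ofReal_lt_top).ne
    refine integral_line_eq_integral_line hhY hG (hGint _ le_rfl ha'.ne) (hGint _ hhY hY.ne')
      hmm hmi (X₀ := |a.re| + 1) ?_
    intro x hx
    have hxa : 1 ≤ |x - a.re| := by
      have := abs_sub_abs_le_abs_sub x a.re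
      linarith
    have hpt : ∀ y ∈ Set.Ioc (-h) Y, ‖G (x + y * Complex.I)‖ₑ ≤
        ‖F' (x + y * Complex.I)‖ₑ ^ 2 + 2 * ‖κ x‖ₑ ^ 2 := by
      intro y hy
      have hne : (x : ℂ) + y * Complex.I ≠ a := by
        intro he
        have : x = a.re := by rw [← he]; simp
        rw [this, sub_self, abs_zero] at hxa
        linarith
      rw [hF'val x y hy.1.le, hGval _ hne, hline]
      set w := F (x + y * Complex.I)
      have e1 : ‖(((x - a.re : ℝ) : ℂ) + ((y - a.im : ℝ) : ℂ) * Complex.I)⁻¹‖ ≤ |x - a.re|⁻¹ := by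
        rw [norm_inv]
        refine inv_anti₀ (by linarith) ?_
        have := Complex.abs_re_le_norm
          (((x - a.re : ℝ) : ℂ) + ((y - a.im : ℝ) : ℂ) * Complex.I)
        simpa using this
      have e2 : (|x - a.re|⁻¹) ^ 2 ≤ 2 * ‖κ x‖ ^ 2 := by
        have h1 : 1 ≤ (x - a.re) ^ 2 := by rw [← sq_abs]; nlinarith
        rw [hκ]
        simp only [norm_inv, inv_pow, sq_abs]
        rw [Complex.norm_add_mul_I, Real.sq_sqrt (by positivity), ← div_eq_mul_inv,
          inv_eq_one_div, div_le_div_iff₀ (by linarith) (by positivity)]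
        linarith
      have e3 : ‖w * (((x - a.re : ℝ) : ℂ) + ((y - a.im : ℝ) : ℂ) * Complex.I)⁻¹‖ ≤
          ‖w‖ ^ 2 + 2 * ‖κ x‖ ^ 2 := by
        rw [norm_mul]
        have h0 : 0 ≤ |x - a.re|⁻¹ := by positivity
        have := mul_le_mul_of_nonneg_left e1 (norm_nonneg w)
        nlinarith [sq_nonneg (‖w‖ - |x - a.re|⁻¹), sq_nonneg (‖w‖ + |x - a.re|⁻¹), norm_nonneg w]
      rw [← ofReal_norm, ← ofReal_norm, ← ofReal_norm,
        ← ENNReal.ofReal_pow (norm_nonneg _), ← ENNReal.ofReal_pow (norm_nonneg _),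
        show (2 : ℝ≥0∞) = ENNReal.ofReal 2 by simp, ← ENNReal.ofReal_mul (by norm_num),
        ← ENNReal.ofReal_add (by positivity) (by positivity)]
      exact ENNReal.ofReal_le_ofReal e3
    refine (setLIntegral_mono' measurableSet_Ioc hpt).trans ?_
    rw [lintegral_add_right _ measurable_const, setLIntegral_const, Real.volume_Ioc, hm,
      sub_neg_eq_add]
    refine le_of_eq ?_
    ring
  have hzero : ∫ x : ℝ, G (x + (-h : ℝ) * Complex.I) = 0 := by
    rw [← enorm_eq_zero]
    have hpi := Real.pi_pos
    have hlim : Tendsto (fun Y : ℝ => N * ENNReal.ofReal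
        (2 * Real.pi * Real.sqrt (1 / (2 * Real.pi * |Y - a.im|)))) atTop (𝓝 0) := by
      have h1 : Tendsto (fun Y : ℝ => 2 * Real.pi * |Y - a.im|) atTop atTop :=
        (tendsto_abs_atTop_atTop.comp
          (tendsto_atTop_add_const_right _ (-a.im) tendsto_id)).const_mul_atTop (by positivity)
      have h2 : Tendsto (fun Y : ℝ => 2 * Real.pi * Real.sqrt (1 / (2 * Real.pi * |Y - a.im|)))
          atTop (𝓝 (2 * Real.pi * Real.sqrt 0)) := by
        refine ((Real.continuous_sqrt.tendsto 0).comp ?_).const_mul _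
        exact tendsto_const_nhds.div_atTop h1
      rw [Real.sqrt_zero, mul_zero] at h2
      have h3 := ENNReal.Tendsto.const_mul (ENNReal.tendsto_ofReal h2) (Or.inr hN)
      simpa using h3
    refine le_antisymm (ge_of_tendsto hlim ?_) zero_le
    filter_upwards [eventually_gt_atTop a.im] with Y hY
    rw [hshift Y hY]
    exact hGbound Y (ha'.trans hY).le hY.ne'
  rw [hGline _ ha'.ne] at hzero
  exact hzero

/-! ### Boundary values and densities -/

theorem memLp_kernelDensity {h : ℝ} {a : ℂ} (ha : a ∈ halfPlane h) :
    MemLp ((Set.Ioi (0 : ℝ)).indicator fun s : ℝ =>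
      Complex.exp (starRingEnd ℂ (rate h a) * s)) 2 volume :=
  (memLp_indicator_iff_restrict measurableSet_Ioi).2 (memLp_cexp (conj_rate_re_neg ha))

/-- On the line `Im z = -h` the kernel `p_a` is the inverse Fourier transform of its density. -/
theorem kernelP_line {h : ℝ} {a : ℂ} (ha : a ∈ halfPlane h) (x : ℝ) :
    kernelP h a (x + (-h : ℝ) * Complex.I) =
      FourierTransformInv.fourierInv ((Set.Ioi (0 : ℝ)).indicator fun s : ℝ =>
        Complex.exp (starRingEnd ℂ (rate h a) * s)) x := by
  set z : ℂ := (x : ℂ) + (-h : ℝ) * Complex.I with hz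
  have hrz : (rate h z).re = 0 := by rw [rate_re, hz]; simp
  have hneg : (rate h z + starRingEnd ℂ (rate h a)).re < 0 := by
    rw [Complex.add_re, hrz, zero_add]; exact conj_rate_re_neg ha
  have h1 := integral_pow_mul_cexp hneg 0
  simp only [pow_zero, one_mul, Nat.factorial_zero, Nat.cast_one, zero_add, pow_one] at h1
  have h2 : FourierTransformInv.fourierInv ((Set.Ioi (0 : ℝ)).indicator fun s : ℝ =>
        Complex.exp (starRingEnd ℂ (rate h a) * s)) x =
      ∫ s in Set.Ioi (0 : ℝ), Complex.exp ((rate h z + starRingEnd ℂ (rate h a)) * s) := by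
    rw [Real.fourierInv_eq', ← integral_indicator measurableSet_Ioi]
    congr 1
    funext s
    by_cases hs : s ∈ Set.Ioi (0 : ℝ)
    · rw [Set.indicator_of_mem hs, Set.indicator_of_mem hs, smul_eq_mul, ← Complex.exp_add]
      congr 1
      simp [rate, hz]
      ring
    · rw [Set.indicator_of_notMem hs, Set.indicator_of_notMem hs, smul_zero]
  rw [h2, h1, one_div_neg_rate_eq_kernelP fun h0 => ?_]
  rw [h0] at hneg
  simp at hneg

theorem kernelP_line_ae {h : ℝ} {a : ℂ} (ha : a ∈ halfPlane h) :
    (Lp.fourierTransformₗᵢ ℝ ℂ).symm (memLp_kernelDensity ha).toLp =ᵐ[volume]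
      fun x : ℝ => kernelP h a (x + (-h : ℝ) * Complex.I) := by
  have h1 : Integrable ((Set.Ioi (0 : ℝ)).indicator fun s : ℝ =>
      Complex.exp (starRingEnd ℂ (rate h a) * s)) := by
    rw [integrable_indicator_iff measurableSet_Ioi]
    simpa using integrableOn_pow_mul_cexp (conj_rate_re_neg ha) 0
  refine (fourierInv_toLp_ae_eq h1 (memLp_kernelDensity ha)).trans ?_
  exact Eventually.of_forall fun x => (kernelP_line ha x).symm

/-- The restriction of a function in `L²(ℝ)` to the positive half-line. -/
def restrictDensity (φ : Lp ℂ 2 (volume : Measure ℝ)) : Density :=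
  ((Lp.memLp φ).restrict (Set.Ioi 0)).toLp

theorem enorm_restrictDensity_le (φ : Lp ℂ 2 (volume : Measure ℝ)) :
    ‖restrictDensity φ‖ₑ ≤ ‖φ‖ₑ := by
  rw [restrictDensity, Lp.enorm_toLp, Lp.enorm_def]
  exact eLpNorm_restrict_le _ _ _ _

theorem inner_kernelDensity {h : ℝ} {a : ℂ} (ha : a ∈ halfPlane h)
    (φ : Lp ℂ 2 (volume : Measure ℝ)) :
    inner ℂ (memLp_kernelDensity ha).toLp φ = laplace h (restrictDensity φ) a := by
  rw [L2.inner_def, laplace, ← integral_indicator measurableSet_Ioi]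
  have h2 := ((Lp.memLp φ).restrict (Set.Ioi 0)).coeFn_toLp
  rw [Filter.EventuallyEq, ae_restrict_iff' measurableSet_Ioi] at h2
  refine integral_congr_ae ?_
  filter_upwards [(memLp_kernelDensity ha).coeFn_toLp, h2] with s h1 h2
  rw [h1, RCLike.inner_apply]
  by_cases hs : s ∈ Set.Ioi (0 : ℝ)
  · rw [Set.indicator_of_mem hs, Set.indicator_of_mem hs, restrictDensity, h2 hs,
      ← Complex.exp_conj, mul_comm]
    simp
  · rw [Set.indicator_of_notMem hs, Set.indicator_of_notMem hs, map_zero, mul_zero]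

/-- Pairing a function in `L²` of the line `Im z = -h` with the boundary values of `p_a` is the
same as evaluating at `a` the transform of its positive frequencies. -/
theorem integral_mul_conj_kernelP_line {h : ℝ} {a : ℂ} (ha : a ∈ halfPlane h) {f : ℝ → ℂ}
    (hf : MemLp f 2 volume) :
    ∫ x : ℝ, f x * starRingEnd ℂ (kernelP h a (x + (-h : ℝ) * Complex.I)) =
      laplace h (restrictDensity (Lp.fourierTransformₗᵢ ℝ ℂ hf.toLp)) a := by
  rw [← inner_kernelDensity ha, ← (Lp.fourierTransformₗᵢ ℝ ℂ).symm.inner_map_map,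
    LinearIsometryEquiv.symm_apply_apply, L2.inner_def]
  refine integral_congr_ae ?_
  filter_upwards [kernelP_line_ae ha, hf.coeFn_toLp] with x h1 h2
  rw [h1, h2, RCLike.inner_apply]

theorem memLp_kernelP_line {h : ℝ} {a : ℂ} (ha : a ∈ halfPlane h) :
    MemLp (fun x : ℝ => kernelP h a (x + (-h : ℝ) * Complex.I)) 2 volume :=
  (memLp_congr_ae (kernelP_line_ae ha)).1 (Lp.memLp _)

theorem integral_kernelP_mul_conj_kernelP_line {h : ℝ} {a : ℂ} (ha : a ∈ halfPlane h) :
    ∫ x : ℝ, kernelP h a (x + (-h : ℝ) * Complex.I) *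
      starRingEnd ℂ (kernelP h a (x + (-h : ℝ) * Complex.I)) = kernelP h a a := by
  rw [integral_mul_conj_kernelP_line ha (memLp_kernelP_line ha), ← laplace_kernelVec ha ha]
  have h1 : (memLp_kernelP_line ha).toLp =
      (Lp.fourierTransformₗᵢ ℝ ℂ).symm (memLp_kernelDensity ha).toLp := by
    refine Lp.ext ?_
    exact (memLp_kernelP_line ha).coeFn_toLp.trans (kernelP_line_ae ha).symm
  rw [h1, LinearIsometryEquiv.apply_symm_apply]
  congr 1
  refine Lp.ext ?_
  have h2 := (memLp_kernelDensity ha).coeFn_toLp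
  refine ((MemLp.coeFn_toLp _).trans (ae_restrict_of_ae h2)).trans ?_
  refine EventuallyEq.trans ?_ (memLp_cexp (conj_rate_re_neg ha)).coeFn_toLp.symm
  filter_upwards [ae_restrict_mem measurableSet_Ioi] with s hs
  rw [Set.indicator_of_mem hs]

theorem conj_kernelP_line {h : ℝ} {a : ℂ} (x : ℝ) :
    starRingEnd ℂ (kernelP h a (x + (-h : ℝ) * Complex.I)) =
      (2 * Real.pi * Complex.I)⁻¹ * ((x : ℂ) + (-h : ℝ) * Complex.I - a)⁻¹ := by
  have h1 : starRingEnd ℂ ((x : ℂ) + (-h : ℝ) * Complex.I - starRingEnd ℂ a + 2 * Complex.I * h) =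
      (x : ℂ) + (-h : ℝ) * Complex.I - a := by
    simp only [map_add, map_sub, map_mul, Complex.conj_conj, Complex.conj_ofReal, Complex.conj_I,
      map_ofNat]
    push_cast; ring
  rw [kernelP, map_div₀, map_mul, map_mul, h1, Complex.conj_I, Complex.conj_ofReal, map_ofNat,
    mul_inv, mul_inv, Complex.inv_I, div_eq_mul_inv, mul_inv]
  ring

/-- The kernel depends on `h` and `a` only through `conj a - 2ih`, so `h` may be enlarged
at the cost of lowering `a`; this makes `p_a` a Hardy function of a larger half-plane. -/
theorem kernelP_eq_of_shift (h H : ℝ) (a ω : ℂ) :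
    kernelP h a ω = kernelP H (a - 2 * (H - h) * Complex.I) ω := by
  rw [kernelP, kernelP]
  congr 2
  simp only [map_sub, map_mul, Complex.conj_I, Complex.conj_ofReal, map_ofNat]
  ring

/-- Cauchy's formula, with the kernel `p_a` as the Cauchy kernel. The zero of `f - c p_a` at `a`
removes the pole. -/
theorem integral_line_mul_conj_kernelP {h : ℝ} {F : ℂ → ℂ} {N : ℝ≥0∞} (hN : N ≠ ∞)
    (hF : DifferentiableOn ℂ F {z | -h ≤ z.im})
    (hFN : ∀ y : ℝ, -h ≤ y → eLpNorm (fun x : ℝ => F (x + y * Complex.I)) 2 volume ≤ N)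
    {a : ℂ} (ha : a ∈ halfPlane h) :
    ∫ x : ℝ, F (x + (-h : ℝ) * Complex.I) *
      starRingEnd ℂ (kernelP h a (x + (-h : ℝ) * Complex.I)) = F a := by
  have ha' : -h < a.im := ha
  set H : ℝ := h + (a.im + h) / 2 with hH
  set b : ℂ := a - 2 * (H - h) * Complex.I with hb
  have hbH : b ∈ halfPlane H := by
    have : b.im = a.im - 2 * (H - h) := by rw [hb]; simp
    change -H < b.im
    rw [this, hH]; linarith
  have hsub : ∀ z : ℂ, -h ≤ z.im → z ∈ halfPlane H := fun z hz => by
    change -H < z.im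
    rw [hH]; linarith
  have hp : ∀ z : ℂ, -h ≤ z.im → kernelP h a z = laplace H (kernelVec hbH) z := fun z hz => by
    rw [kernelP_eq_of_shift h H, laplace_kernelVec hbH (hsub z hz)]
  have hpa := kernelP_ne_zero ha ha
  set c : ℂ := F a / kernelP h a a with hc
  have hlineim : ∀ x y : ℝ, ((x : ℂ) + y * Complex.I).im = y := fun x y => by simp
  have hpd : DifferentiableOn ℂ (kernelP h a) {z | -h ≤ z.im} :=
    ((differentiableOn_laplace H (kernelVec hbH)).mono hsub).congr fun z hz => hp z hz
  have hpN : ∀ y : ℝ, -h ≤ y →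
      eLpNorm (fun x : ℝ => kernelP h a (x + y * Complex.I)) 2 volume ≤ ‖kernelVec hbH‖ₑ := by
    intro y hy
    rw [← hardyNorm_laplace]
    simp only [fun x : ℝ => hp (x + y * Complex.I) (by rw [hlineim]; exact hy)]
    exact le_iSup₂ (f := fun (y : ℝ) (_ : -H < y) =>
        eLpNorm (fun x : ℝ => laplace H (kernelVec hbH) (x + y * Complex.I)) 2 volume) y
        (by rw [hH]; linarith)
  have hline : ∀ y : ℝ, -h ≤ y → ∀ {f : ℂ → ℂ}, DifferentiableOn ℂ f {z | -h ≤ z.im} →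
      AEStronglyMeasurable (fun x : ℝ => f (x + y * Complex.I)) volume := fun y hy f hf =>
    (hf.continuousOn.comp_continuous (by fun_prop)
      fun x => by simpa using hy).aestronglyMeasurable
  have key := integral_line_div_eq_zero (F := fun z => F z - c * kernelP h a z)
    (N := N + ‖c‖ₑ * ‖kernelVec hbH‖ₑ)
    (ENNReal.add_ne_top.2 ⟨hN, ENNReal.mul_ne_top enorm_ne_top enorm_ne_top⟩)
    (hF.sub (hpd.const_mul c)) (fun y hy => ?_) ha
    (by rw [hc, div_mul_cancel₀ _ hpa, sub_self])
  · have hF2 : MemLp (fun x : ℝ => F (x + (-h : ℝ) * Complex.I)) 2 volume :=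
      ⟨hline _ le_rfl hF, (hFN _ le_rfl).trans_lt hN.lt_top⟩
    have i1 : Integrable fun x : ℝ => F (x + (-h : ℝ) * Complex.I) *
        starRingEnd ℂ (kernelP h a (x + (-h : ℝ) * Complex.I)) :=
      hF2.integrable_mul (memLp_kernelP_line ha).star
    have i2 : Integrable fun x : ℝ => c * (kernelP h a (x + (-h : ℝ) * Complex.I) *
        starRingEnd ℂ (kernelP h a (x + (-h : ℝ) * Complex.I))) :=
      ((memLp_kernelP_line ha).integrable_mul (memLp_kernelP_line ha).star).const_mul c
    have h1 := integral_sub i1 i2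
    rw [integral_const_mul, integral_kernelP_mul_conj_kernelP_line ha, hc,
      div_mul_cancel₀ _ hpa] at h1
    rw [← sub_eq_zero, ← h1, ← mul_zero (2 * (Real.pi : ℂ) * Complex.I)⁻¹, ← key,
      ← integral_const_mul]
    congr 1
    funext x
    rw [conj_kernelP_line, hc]
    ring
  · refine (eLpNorm_sub_le (hline y hy hF) (hline y hy (hpd.const_mul c)) (by norm_num)).trans ?_
    refine add_le_add (hFN y hy) ?_
    have := eLpNorm_const_smul c (fun x : ℝ => kernelP h a (x + y * Complex.I)) 2 volume
    refine (le_of_eq this).trans ?_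
    gcongr
    exact hpN y hy

/-- A function of Hardy class, translated into the interior of the half-plane, is the Laplace
transform of a density of no larger norm. -/
theorem exists_density_of_shift {h : ℝ} {f : ℂ → ℂ} (hf : MemH2 h f) {δ : ℝ} (hδ : 0 < δ) :
    ∃ g : Density, ‖g‖ₑ ≤ hardyNorm h f ∧
      ∀ a ∈ halfPlane h, f (a + δ * Complex.I) = laplace h g a := by
  set F : ℂ → ℂ := fun z => f (z + δ * Complex.I) with hFdef
  have hF : DifferentiableOn ℂ F {z | -h ≤ z.im} := by
    refine hf.analytic.comp (by fun_prop) fun z hz => ?_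
    have hz' : -h ≤ z.im := hz
    change -h < (z + δ * Complex.I).im
    simp; linarith
  have hFN : ∀ y : ℝ, -h ≤ y →
      eLpNorm (fun x : ℝ => F (x + y * Complex.I)) 2 volume ≤ hardyNorm h f := by
    intro y hy
    refine le_trans (le_of_eq ?_) (le_iSup₂ (f := fun (y : ℝ) (_ : -h < y) =>
        eLpNorm (fun x : ℝ => f (x + y * Complex.I)) 2 volume) (y + δ) (by linarith))
    congr 1
    funext x
    rw [hFdef]
    push_cast
    ring_nf
  have hF2 : MemLp (fun x : ℝ => F (x + (-h : ℝ) * Complex.I)) 2 volume :=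
    ⟨(hF.continuousOn.comp_continuous (by fun_prop) fun x => by simp).aestronglyMeasurable,
      (hFN _ le_rfl).trans_lt hf.bounded⟩
  refine ⟨restrictDensity (Lp.fourierTransformₗᵢ ℝ ℂ hF2.toLp), ?_, fun a ha => ?_⟩
  · refine (enorm_restrictDensity_le _).trans ?_
    rw [(Lp.fourierTransformₗᵢ ℝ ℂ).enorm_map, Lp.enorm_toLp]
    exact hFN _ le_rfl
  · rw [← integral_mul_conj_kernelP_line ha hF2,
      integral_line_mul_conj_kernelP hf.bounded.ne hF hFN ha]

/-- An inequality between evaluation at a point, the norm on the interval and the Hardy norm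
passes from Laplace transforms to all functions of Hardy class. -/
theorem norm_apply_le_of_density {h : ℝ} (hh : 0 < h) {a : ℂ} (ha : a ∈ halfPlane h) {c₁ c₀ : ℝ}
    (hc₁ : 0 ≤ c₁) (hc₀ : 0 ≤ c₀)
    (H : ∀ g : Density, ‖laplace h g a‖ ≤ c₁ * ‖restrictOp hh g‖ + c₀ * ‖g‖)
    {f : ℂ → ℂ} (hf : MemH2 h f) :
    ‖f a‖ ≤ c₁ * (intervalNorm f).toReal + c₀ * (hardyNorm h f).toReal := by
  have hfd := hf.analytic
  set fs : ℝ → ℂ → ℂ := fun δ z => f (z + δ * Complex.I) with hfs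
  have hshift : ∀ {z : ℂ}, z ∈ halfPlane h → ∀ {δ : ℝ}, 0 ≤ δ →
      z + δ * Complex.I ∈ halfPlane h := by
    intro z hz δ hδ
    have hz' : -h < z.im := hz
    change -h < (z + δ * Complex.I).im
    simp; linarith
  have hfsd : ∀ δ : ℝ, 0 ≤ δ → DifferentiableOn ℂ (fs δ) (halfPlane h) := fun δ hδ =>
    hfd.comp (by fun_prop) fun z hz => hshift hz hδ
  have hbound : ∀ δ : ℝ, 0 < δ → ‖fs δ a‖ ≤
      c₁ * ‖intervalRestrict hh hfd‖ + c₁ * (intervalNorm (fs δ - f)).toReal +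
        c₀ * (hardyNorm h f).toReal := by
    intro δ hδ
    obtain ⟨g, hg, hga⟩ := exists_density_of_shift hf hδ
    have h1 : ‖g‖ ≤ (hardyNorm h f).toReal := by
      rw [← toReal_enorm]; exact ENNReal.toReal_mono hf.bounded.ne hg
    have hdiff : DifferentiableOn ℂ (fs δ - f) (halfPlane h) := (hfsd δ hδ.le).sub hfd
    have h2 : restrictOp hh g = intervalRestrict hh hfd + intervalRestrict hh hdiff := by
      refine Lp.ext ?_
      filter_upwards [intervalRestrict_ae hh (differentiableOn_laplace h g),
        intervalRestrict_ae hh hfd, intervalRestrict_ae hh hdiff,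
        Lp.coeFn_add (intervalRestrict hh hfd) (intervalRestrict hh hdiff)] with x e1 e2 e3 e4
      rw [restrictOp_apply, e1, e4, Pi.add_apply, e2, e3, Pi.sub_apply,
        ← hga _ (ofReal_mem_halfPlane hh x)]
      ring
    have h3 : ‖restrictOp hh g‖ ≤
        ‖intervalRestrict hh hfd‖ + (intervalNorm (fs δ - f)).toReal := by
      rw [h2, ← enorm_intervalRestrict hh hdiff, toReal_enorm]
      exact norm_add_le _ _
    have h4 := H g
    rw [← hga a ha] at h4
    have h5 := mul_le_mul_of_nonneg_left h3 hc₁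
    have h6 := mul_le_mul_of_nonneg_left h1 hc₀
    change ‖f (a + δ * Complex.I)‖ ≤ _
    linarith
  have hlim1 : Tendsto (fun δ : ℝ => ‖fs δ a‖) (𝓝[>] 0) (𝓝 ‖f a‖) := by
    have h1 : ContinuousAt f (a + (0 : ℝ) * Complex.I) := by
      rw [Complex.ofReal_zero, zero_mul, add_zero]
      exact hfd.continuousOn.continuousAt ((isOpen_halfPlane h).mem_nhds ha)
    have h2 : ContinuousAt (fun δ : ℝ => f (a + δ * Complex.I)) 0 :=
      ContinuousAt.comp (f := fun δ : ℝ => a + δ * Complex.I) h1 (by fun_prop)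
    have h3 := h2.tendsto.norm
    rw [Complex.ofReal_zero, zero_mul, add_zero] at h3
    exact h3.mono_left nhdsWithin_le_nhds
  have hlim2 : Tendsto (fun δ : ℝ => (intervalNorm (fs δ - f)).toReal) (𝓝[>] 0) (𝓝 0) := by
    -- the translates converge uniformly on the compact interval
    have hcont : ContinuousOn (fun p : ℝ × ℝ => f (p.1 + p.2 * Complex.I))
        (Set.Icc (-1) 1 ×ˢ Set.Icc 0 1) := by
      refine hfd.continuousOn.comp (by fun_prop) fun p hp => ?_
      exact hshift (ofReal_mem_halfPlane hh p.1) hp.2.1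
    have huc := (isCompact_Icc.prod isCompact_Icc).uniformContinuousOn_of_continuous hcont
    rw [Metric.uniformContinuousOn_iff] at huc
    rw [Metric.tendsto_nhds]
    intro ε hε
    obtain ⟨d, hd, hud⟩ := huc (ε / 4) (by positivity)
    have hmem : Set.Ioo 0 (min d 1) ∈ 𝓝[>] (0 : ℝ) := Ioo_mem_nhdsGT (by positivity)
    filter_upwards [hmem] with δ hδ
    have hδd : δ < d := hδ.2.trans_le (min_le_left _ _)
    have hδ1 : δ < 1 := hδ.2.trans_le (min_le_right _ _)
    have hb : ∀ᵐ x : ℝ ∂(volume : Measure ℝ).restrict (Set.Ioo (-1) 1),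
        ‖(fs δ - f) (x : ℂ)‖ ≤ ε / 4 := by
      filter_upwards [ae_restrict_mem measurableSet_Ioo] with x hx
      have hx' := Set.Ioo_subset_Icc_self hx
      have := hud (x, δ) ⟨hx', hδ.1.le, hδ1.le⟩ (x, 0) ⟨hx', le_rfl, zero_le_one⟩
        (by
          rw [Prod.dist_eq, dist_self, Real.dist_eq, sub_zero, abs_of_pos hδ.1]
          simpa using ⟨hd, hδd⟩)
      simp only [Complex.ofReal_zero, zero_mul, add_zero, dist_eq_norm] at this
      exact this.le
    have h1 := eLpNorm_le_of_ae_bound (p := 2) hb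
    have h2 : ((volume : Measure ℝ).restrict (Set.Ioo (-1) 1)) Set.univ ^
        (2 : ℝ≥0∞).toReal⁻¹ ≤ 2 := by
      rw [Measure.restrict_apply_univ, Real.volume_Ioo]
      norm_num
      calc (2 : ℝ≥0∞) ^ ((1 : ℝ) / 2) ≤ 2 ^ (1 : ℝ) :=
            ENNReal.rpow_le_rpow_of_exponent_le (by norm_num) (by norm_num)
        _ = 2 := ENNReal.rpow_one 2
    have h3 : intervalNorm (fs δ - f) ≤ ENNReal.ofReal (2 * (ε / 4)) := by
      rw [ENNReal.ofReal_mul (by norm_num), ENNReal.ofReal_ofNat]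
      exact h1.trans (mul_le_mul' h2 le_rfl)
    have h4 := ENNReal.toReal_mono ENNReal.ofReal_ne_top h3
    rw [ENNReal.toReal_ofReal (by positivity)] at h4
    rw [Real.dist_eq, sub_zero, abs_of_nonneg ENNReal.toReal_nonneg]
    linarith
  have hfin : Tendsto (fun δ : ℝ => c₁ * ‖intervalRestrict hh hfd‖ +
      c₁ * (intervalNorm (fs δ - f)).toReal + c₀ * (hardyNorm h f).toReal) (𝓝[>] 0)
      (𝓝 (c₁ * ‖intervalRestrict hh hfd‖ + c₁ * 0 + c₀ * (hardyNorm h f).toReal)) :=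
    (tendsto_const_nhds.add (hlim2.const_mul c₁)).add_const _
  rw [mul_zero, add_zero] at hfin
  rw [← enorm_intervalRestrict hh hfd, toReal_enorm]
  refine le_of_tendsto_of_tendsto hlim1 hfin ?_
  filter_upwards [self_mem_nhdsWithin] with δ hδ using hbound δ hδ

/-! ### Solutions of the resolvent equation -/

theorem hardyNorm_congr {h : ℝ} {f g : ℂ → ℂ} (hfg : ∀ z ∈ halfPlane h, f z = g z) :
    hardyNorm h f = hardyNorm h g := by
  refine iSup_congr fun y => iSup_congr fun hy => ?_
  simp only [fun x : ℝ => hfg _ (mem_halfPlane_line hy x)]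

theorem intervalNorm_congr {h : ℝ} (hh : 0 < h) {f g : ℂ → ℂ}
    (hfg : ∀ z ∈ halfPlane h, f z = g z) : intervalNorm f = intervalNorm g := by
  simp only [intervalNorm, fun x : ℝ => hfg _ (ofReal_mem_halfPlane hh x)]

/-- The density of `(𝒦 + η)⁻¹ p_{ω₀}`. -/
def resolventVec {h : ℝ} (hh : 0 < h) (ω₀ η : ℝ) : Density :=
  regVec (restrictOp hh) (kernelVec (ofReal_mem_halfPlane hh ω₀)) η

theorem isResolventSol_laplace {h : ℝ} (hh : 0 < h) (ω₀ : ℝ) {η : ℝ} (hη : 0 < η) :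
    IsResolventSol h ω₀ η (laplace h (resolventVec hh ω₀ η)) := by
  refine ⟨memH2_laplace h _, fun ω hω => ?_⟩
  have s1 : (restrictOp hh).adjoint (restrictOp hh (resolventVec hh ω₀ η)) +
      (η : ℂ) • resolventVec hh ω₀ η = kernelVec (ofReal_mem_halfPlane hh ω₀) :=
    shiftedGram_regVec _ _ hη
  rw [← laplace_kernelVec (ofReal_mem_halfPlane hh ω₀) hω, ← s1, laplace_add hω, laplace_smul hω,
    restrictOp_apply, laplace_adjoint_intervalRestrict hh hω]

/-- A solution `u` of the resolvent equation is `(p - R†(u|_{(-1,1)})) / η`, hence a Laplace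
transform. -/
theorem IsResolventSol.eq_laplace {h ω₀ η : ℝ} {u : ℂ → ℂ} (hu : IsResolventSol h ω₀ η u)
    (hh : 0 < h) (hη : 0 < η) :
    ∀ ω ∈ halfPlane h, u ω = laplace h (resolventVec hh ω₀ η) ω := by
  have hη0 : (η : ℂ) ≠ 0 := by exact_mod_cast hη.ne'
  set v := intervalRestrict hh hu.mem.analytic with hv
  set g : Density := (η : ℂ)⁻¹ • (kernelVec (ofReal_mem_halfPlane hh ω₀) +
    (-1 : ℂ) • (restrictOp hh).adjoint v) with hg
  have hug : ∀ ω ∈ halfPlane h, u ω = laplace h g ω := by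
    intro ω hω
    rw [hg, laplace_smul hω, laplace_add hω, laplace_smul hω,
      laplace_kernelVec (ofReal_mem_halfPlane hh ω₀) hω, hv,
      laplace_adjoint_intervalRestrict hh hω, ← hu.eqn ω hω]
    field_simp
    ring
  have hRg : restrictOp hh g = v := by
    refine Lp.ext ?_
    filter_upwards [intervalRestrict_ae hh hu.mem.analytic,
      intervalRestrict_ae hh (differentiableOn_laplace h g)] with x h1 h2
    rw [restrictOp_apply, h2, hv, h1, hug _ (ofReal_mem_halfPlane hh x)]
  have hgeq : g = resolventVec hh ω₀ η := by
    refine eq_regVec _ _ hη ?_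
    change (restrictOp hh).adjoint (restrictOp hh g) + (η : ℂ) • g = _
    rw [hRg, hg, smul_smul, mul_inv_cancel₀ hη0, one_smul, neg_one_smul]
    abel
  intro ω hω
  rw [hug ω hω, hgeq]

theorem IsResolventSol.hardyNorm_eq {h ω₀ η : ℝ} {u : ℂ → ℂ} (hu : IsResolventSol h ω₀ η u)
    (hh : 0 < h) (hη : 0 < η) : hardyNorm h u = ‖resolventVec hh ω₀ η‖ₑ := by
  rw [hardyNorm_congr (hu.eq_laplace hh hη), hardyNorm_laplace]

theorem IsResolventSol.intervalNorm_eq {h ω₀ η : ℝ} {u : ℂ → ℂ} (hu : IsResolventSol h ω₀ η u)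
    (hh : 0 < h) (hη : 0 < η) : intervalNorm u = ‖restrictOp hh (resolventVec hh ω₀ η)‖ₑ := by
  rw [intervalNorm_congr hh (hu.eq_laplace hh hη), enorm_restrictOp]

theorem isEta_iff {h ω₀ : ℝ} (hh : 0 < h) (ε η : ℝ) : IsEta h ω₀ ε η ↔
    0 < η ∧ normRatio (restrictOp hh) (kernelVec (ofReal_mem_halfPlane hh ω₀)) η = ε := by
  have hRp := restrictOp_kernelVec_ne_zero hh (ofReal_mem_halfPlane hh ω₀)
  constructor
  · rintro ⟨hη, u, hu, heq⟩
    refine ⟨hη, ?_⟩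
    have hU := norm_pos_iff.2 (regVec_ne_zero hRp hη)
    have hRU := norm_pos_iff.2 (map_regVec_ne_zero hRp hη)
    rw [hu.hardyNorm_eq hh hη, hu.intervalNorm_eq hh hη] at heq
    have h1 := congrArg ENNReal.toReal heq
    rw [ENNReal.toReal_mul, toReal_enorm, toReal_enorm] at h1
    rcases le_or_gt ε 0 with hε | hε
    · rw [ENNReal.ofReal_of_nonpos hε, ENNReal.toReal_zero, zero_mul] at h1
      exact absurd h1 hRU.ne'
    · rw [ENNReal.toReal_ofReal hε.le] at h1
      exact (div_eq_iff hU.ne').2 h1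
  · rintro ⟨hη, rfl⟩
    refine ⟨hη, _, isResolventSol_laplace hh ω₀ hη, ?_⟩
    rw [hardyNorm_laplace, ← enorm_restrictOp hh, ← ofReal_norm, ← ofReal_norm,
      ← ENNReal.ofReal_mul (normRatio_pos hRp hη).le]
    congr 1
    exact norm_map_regVec hRp hη

theorem epsStar_eq {h : ℝ} (hh : 0 < h) (ω₀ : ℝ) : epsStar h ω₀ =
    ‖restrictOp hh (kernelVec (ofReal_mem_halfPlane hh ω₀))‖ /
      ‖kernelVec (ofReal_mem_halfPlane hh ω₀)‖ := by
  have hp : ∀ z ∈ halfPlane h, kernelP h ω₀ z =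
      laplace h (kernelVec (ofReal_mem_halfPlane hh ω₀)) z := fun z hz =>
    (laplace_kernelVec _ hz).symm
  rw [epsStar, hardyNorm_congr hp, intervalNorm_congr hh hp, hardyNorm_laplace,
    ← enorm_restrictOp hh, toReal_enorm, toReal_enorm]

theorem norm_kernelVec_pos {h : ℝ} (hh : 0 < h) (ω₀ : ℝ) :
    0 < ‖kernelVec (ofReal_mem_halfPlane hh ω₀)‖ :=
  (norm_nonneg _).trans_lt (norm_restrictOp_kernelVec_lt hh)

theorem epsStar_pos {h : ℝ} (hh : 0 < h) (ω₀ : ℝ) : 0 < epsStar h ω₀ := by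
  rw [epsStar_eq hh]
  exact div_pos (norm_pos_iff.2 (restrictOp_kernelVec_ne_zero hh _)) (norm_kernelVec_pos hh ω₀)

theorem epsStar_lt_one {h : ℝ} (hh : 0 < h) (ω₀ : ℝ) : epsStar h ω₀ < 1 := by
  rw [epsStar_eq hh]
  exact (div_lt_one (norm_kernelVec_pos hh ω₀)).2 (norm_restrictOp_kernelVec_lt hh)

theorem solvable_eq {h ω₀ : ℝ} (hh : 0 < h) (hω₀ : 1 < ω₀) :
    solvable h ω₀ = Set.Ioo 0 (epsStar h ω₀) := by
  rw [epsStar_eq hh, ← image_normRatio (restrictOp_kernelVec_ne_zero hh _)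
    (exists_small_on_interval hh hω₀)]
  ext ε
  simp only [solvable, Set.mem_ofPred_eq, isEta_iff hh, Set.mem_image, Set.mem_Ioi]

theorem IsEta.unique {h ω₀ ε η₁ η₂ : ℝ} (hh : 0 < h) (hω₀ : 1 < ω₀) (h₁ : IsEta h ω₀ ε η₁)
    (h₂ : IsEta h ω₀ ε η₂) : η₁ = η₂ := by
  rw [isEta_iff hh] at h₁ h₂
  exact injOn_normRatio (restrictOp_kernelVec_ne_zero hh _) (exists_small_on_interval hh hω₀)
    h₁.1 h₂.1 (h₁.2.trans h₂.2.symm)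

/-! ### The extremal problem -/

/-- A dual bound for densities bounds all competitors in the extremal problem. -/
theorem norm_apply_le_of_competitor {h : ℝ} (hh : 0 < h) (ω₀ : ℝ) {c₁ c₀ : ℝ} (hc₁ : 0 ≤ c₁)
    (hc₀ : 0 ≤ c₀) (H : ∀ g : Density, ‖inner ℂ (kernelVec (ofReal_mem_halfPlane hh ω₀)) g‖ ≤
      c₁ * ‖restrictOp hh g‖ + c₀ * ‖g‖) {ε : ℝ} (hε : 0 ≤ ε) {f : ℂ → ℂ} (hf : MemH2 h f)
    (hf1 : hardyNorm h f ≤ 1) (hf2 : intervalNorm f ≤ ENNReal.ofReal ε) :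
    ‖f ω₀‖ ≤ c₁ * ε + c₀ := by
  simp only [inner_kernelVec] at H
  refine (norm_apply_le_of_density hh (ofReal_mem_halfPlane hh ω₀) hc₁ hc₀ H hf).trans ?_
  have h1 : (hardyNorm h f).toReal ≤ 1 := by
    simpa using ENNReal.toReal_mono ENNReal.one_ne_top hf1
  have h2 : (intervalNorm f).toReal ≤ ε := by
    have := ENNReal.toReal_mono ENNReal.ofReal_ne_top hf2
    rwa [ENNReal.toReal_ofReal hε] at this
  have h3 := mul_le_mul_of_nonneg_left h2 hc₁
  have h4 := mul_le_mul_of_nonneg_left h1 hc₀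
  linarith

theorem extremalD_le {h : ℝ} (hh : 0 < h) (ω₀ : ℝ) {c₁ c₀ : ℝ} (hc₁ : 0 ≤ c₁)
    (hc₀ : 0 ≤ c₀) (H : ∀ g : Density, ‖inner ℂ (kernelVec (ofReal_mem_halfPlane hh ω₀)) g‖ ≤
      c₁ * ‖restrictOp hh g‖ + c₀ * ‖g‖) {ε : ℝ} (hε : 0 ≤ ε) :
    extremalD h ω₀ ε ≤ c₁ * ε + c₀ := by
  refine Real.sSup_le ?_ (by positivity)
  rintro r ⟨f, hf, hf1, hf2, rfl⟩
  exact norm_apply_le_of_competitor hh ω₀ hc₁ hc₀ H hε hf hf1 hf2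

theorem norm_inner_kernelVec_le {h : ℝ} (hh : 0 < h) (ω₀ : ℝ) (g : Density) :
    ‖inner ℂ (kernelVec (ofReal_mem_halfPlane hh ω₀)) g‖ ≤
      0 * ‖restrictOp hh g‖ + ‖kernelVec (ofReal_mem_halfPlane hh ω₀)‖ * ‖g‖ := by
  rw [zero_mul, zero_add]; exact norm_inner_le_norm _ _

theorem le_extremalD {h : ℝ} (hh : 0 < h) (ω₀ : ℝ) {ε : ℝ} (hε : 0 ≤ ε) {g : Density}
    (hg1 : ‖g‖ ≤ 1) (hg2 : ‖restrictOp hh g‖ ≤ ε) :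
    ‖inner ℂ (kernelVec (ofReal_mem_halfPlane hh ω₀)) g‖ ≤ extremalD h ω₀ ε := by
  refine le_csSup ⟨‖kernelVec (ofReal_mem_halfPlane hh ω₀)‖, ?_⟩
    ⟨laplace h g, memH2_laplace h g, ?_, ?_, by rw [inner_kernelVec]⟩
  · rintro r ⟨f, hf, hf1, hf2, rfl⟩
    simpa using norm_apply_le_of_competitor hh ω₀ le_rfl (norm_nonneg _)
      (norm_inner_kernelVec_le hh ω₀) hε hf hf1 hf2
  · rw [hardyNorm_laplace, ← ofReal_norm]
    exact ENNReal.ofReal_le_one.2 hg1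
  · rw [← enorm_restrictOp hh, ← ofReal_norm]
    exact ENNReal.ofReal_le_ofReal hg2

theorem extremalD_le_norm {h : ℝ} (hh : 0 < h) (ω₀ : ℝ) {ε : ℝ} (hε : 0 ≤ ε) :
    extremalD h ω₀ ε ≤ ‖kernelVec (ofReal_mem_halfPlane hh ω₀)‖ := by
  simpa using extremalD_le hh ω₀ le_rfl (norm_nonneg _) (norm_inner_kernelVec_le hh ω₀) hε

/-- Multiples of the kernel itself are competitors in the extremal problem. -/
theorem mul_norm_le_extremalD {h : ℝ} (hh : 0 < h) (ω₀ : ℝ) {ε c : ℝ} (hε : 0 ≤ ε) (hc : 0 ≤ c)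
    (hc1 : c ≤ 1) (hcε : c * epsStar h ω₀ ≤ ε) :
    c * ‖kernelVec (ofReal_mem_halfPlane hh ω₀)‖ ≤ extremalD h ω₀ ε := by
  have hp := norm_kernelVec_pos hh ω₀
  rw [epsStar_eq hh] at hcε
  set p := kernelVec (ofReal_mem_halfPlane hh ω₀) with hpdef
  have hn : ‖((c / ‖p‖ : ℝ) : ℂ)‖ = c / ‖p‖ := by
    rw [Complex.norm_real, Real.norm_of_nonneg (by positivity)]
  have h1 := le_extremalD hh ω₀ hε (g := ((c / ‖p‖ : ℝ) : ℂ) • p) ?_ ?_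
  · refine le_trans (le_of_eq ?_) h1
    rw [← hpdef, inner_smul_right, norm_mul, hn, inner_self_eq_norm_sq_to_K]
    simp only [norm_pow, RCLike.norm_ofReal, abs_norm]
    field_simp
  · rw [norm_smul, hn, div_mul_cancel₀ _ hp.ne']; exact hc1
  · rw [map_smul, norm_smul, hn]
    refine le_trans (le_of_eq ?_) hcε
    ring

theorem extremalD_eq_norm {h : ℝ} (hh : 0 < h) (ω₀ : ℝ) {ε : ℝ} (hε : epsStar h ω₀ ≤ ε) :
    extremalD h ω₀ ε = ‖kernelVec (ofReal_mem_halfPlane hh ω₀)‖ := by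
  have h0 := (epsStar_pos hh ω₀).le.trans hε
  refine le_antisymm (extremalD_le_norm hh ω₀ h0) ?_
  simpa using mul_norm_le_extremalD hh ω₀ h0 zero_le_one le_rfl (by simpa using hε)

theorem extremalD_pos {h : ℝ} (hh : 0 < h) (ω₀ : ℝ) {ε : ℝ} (hε : 0 < ε) :
    0 < extremalD h ω₀ ε := by
  have he := epsStar_pos hh ω₀
  refine lt_of_lt_of_le (mul_pos (show 0 < min 1 (ε / epsStar h ω₀) by positivity)
    (norm_kernelVec_pos hh ω₀)) (mul_norm_le_extremalD hh ω₀ hε.le (by positivity)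
      (min_le_left _ _) ?_)
  calc _ ≤ ε / epsStar h ω₀ * epsStar h ω₀ := mul_le_mul_of_nonneg_right (min_le_right _ _) he.le
    _ = ε := div_mul_cancel₀ _ he.ne'

/-- Each resolvent vector gives an affine majorant of the extremal function. -/
theorem extremalD_le_affine {h : ℝ} (hh : 0 < h) (ω₀ : ℝ) {η x : ℝ} (hη : 0 < η) (hx : 0 ≤ x) :
    extremalD h ω₀ x ≤ ‖restrictOp hh (resolventVec hh ω₀ η)‖ * x +
      η * ‖resolventVec hh ω₀ η‖ :=
  extremalD_le hh ω₀ (norm_nonneg _) (by positivity)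
    (fun g => norm_inner_le _ _ hη g) hx

theorem IsEta.norm_restrictOp {h ω₀ ε η : ℝ} (hη : IsEta h ω₀ ε η) (hh : 0 < h) :
    ‖restrictOp hh (resolventVec hh ω₀ η)‖ = ε * ‖resolventVec hh ω₀ η‖ := by
  obtain ⟨h1, h2⟩ := (isEta_iff hh ε η).1 hη
  rw [← h2]
  exact norm_map_regVec (restrictOp_kernelVec_ne_zero hh _) h1

theorem norm_resolventVec_pos {h : ℝ} (hh : 0 < h) (ω₀ : ℝ) {η : ℝ} (hη : 0 < η) :
    0 < ‖resolventVec hh ω₀ η‖ :=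
  norm_pos_iff.2 (regVec_ne_zero (restrictOp_kernelVec_ne_zero hh _) hη)

/-- The normalized solution `u^*` is extremal. -/
theorem IsEta.extremalD_eq {h ω₀ ε η : ℝ} (hη : IsEta h ω₀ ε η) (hh : 0 < h) (hε : 0 ≤ ε) :
    extremalD h ω₀ ε = (ε ^ 2 + η) * ‖resolventVec hh ω₀ η‖ := by
  have hη0 := hη.1
  have hU := norm_resolventVec_pos hh ω₀ hη0
  have hR := hη.norm_restrictOp hh
  refine le_antisymm ((extremalD_le_affine hh ω₀ hη0 hε).trans_eq (by rw [hR]; ring)) ?_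
  set U := resolventVec hh ω₀ η with hUdef
  have hn : ‖((‖U‖⁻¹ : ℝ) : ℂ)‖ = ‖U‖⁻¹ := by
    rw [Complex.norm_real, Real.norm_of_nonneg (by positivity)]
  have h1 := le_extremalD hh ω₀ hε (g := ((‖U‖⁻¹ : ℝ) : ℂ) • U) ?_ ?_
  · refine le_trans (le_of_eq ?_) h1
    have h2 : ‖inner ℂ (kernelVec (ofReal_mem_halfPlane hh ω₀)) U‖ =
        ‖restrictOp hh U‖ ^ 2 + η * ‖U‖ ^ 2 := norm_inner_regVec _ _ hη0
    rw [inner_smul_right, norm_mul, hn, h2, hR]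
    field_simp
  · rw [norm_smul, hn, inv_mul_cancel₀ hU.ne']
  · rw [map_smul, norm_smul, hn, hR]
    refine le_of_eq ?_
    field_simp

/-- `η` is the inverse of a strictly increasing function on an interval, hence monotone with an
interval as its image. -/
theorem continuousOn_eta {h ω₀ : ℝ} (hh : 0 < h) (hω₀ : 1 < ω₀) {η : ℝ → ℝ}
    (hη : ∀ ε ∈ solvable h ω₀, IsEta h ω₀ ε (η ε)) : ContinuousOn η (solvable h ω₀) := by
  have hRp := restrictOp_kernelVec_ne_zero hh (ofReal_mem_halfPlane hh ω₀)
  have hm := strictMonoOn_normRatio hRp (exists_small_on_interval hh hω₀)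
  have hopen : IsOpen (solvable h ω₀) := by rw [solvable_eq hh hω₀]; exact isOpen_Ioo
  have himg : η '' solvable h ω₀ = Set.Ioi 0 := by
    ext e
    constructor
    · rintro ⟨ε, hε, rfl⟩; exact (hη ε hε).1
    · intro he
      have h1 := (isEta_iff (ω₀ := ω₀) hh _ e).2 ⟨he, rfl⟩
      exact ⟨_, ⟨e, h1⟩, (hη _ ⟨e, h1⟩).unique hh hω₀ h1⟩
  have hmono : MonotoneOn η (solvable h ω₀) := by
    intro x hx y hy hxy
    obtain ⟨a1, a2⟩ := (isEta_iff hh _ _).1 (hη x hx)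
    obtain ⟨b1, b2⟩ := (isEta_iff hh _ _).1 (hη y hy)
    rw [← a2, ← b2] at hxy
    exact (hm.le_iff_le a1 b1).1 hxy
  intro ε hε
  refine (continuousAt_of_monotoneOn_of_image_mem_nhds hmono
    (hopen.mem_nhds hε) ?_).continuousWithinAt
  rw [himg]
  exact Ioi_mem_nhds (hη ε hε).1

theorem hasDerivAt_extremalD {h ω₀ : ℝ} (hh : 0 < h) (hω₀ : 1 < ω₀) {η : ℝ → ℝ}
    (hη : ∀ ε ∈ solvable h ω₀, IsEta h ω₀ ε (η ε)) {ε : ℝ} (hε : ε ∈ solvable h ω₀) :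
    HasDerivAt (extremalD h ω₀) ‖restrictOp hh (resolventVec hh ω₀ (η ε))‖ ε := by
  have hs := solvable_eq hh hω₀
  have hpos : ∀ x ∈ solvable h ω₀, 0 ≤ x := fun x hx => by rw [hs] at hx; exact hx.1.le
  refine hasDerivAt_of_touching
    (s := fun ε => ‖restrictOp hh (resolventVec hh ω₀ (η ε))‖) (S := solvable h ω₀)
    (by rw [hs]; exact isOpen_Ioo) ?_ ?_ hε
  · intro y hy x hx
    refine (extremalD_le_affine hh ω₀ (hη y hy).1 (hpos x hx)).trans_eq ?_
    rw [(hη y hy).extremalD_eq hh (hpos y hy), (hη y hy).norm_restrictOp hh]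
    ring
  · have h1 : ContinuousOn (fun e => resolventVec hh ω₀ e) (Set.Ioi 0) := continuousOn_regVec _ _
    exact ((restrictOp hh).continuous.comp_continuousOn
      (h1.comp (continuousOn_eta hh hω₀ hη) fun x hx => (hη x hx).1)).norm

theorem continuousOn_extremalD {h ω₀ : ℝ} (hh : 0 < h) (hω₀ : 1 < ω₀) {η : ℝ → ℝ}
    (hη : ∀ ε ∈ solvable h ω₀, IsEta h ω₀ ε (η ε)) :
    ContinuousOn (extremalD h ω₀) (Set.Ioi 0) := by
  have hs := solvable_eq hh hω₀
  have he := epsStar_pos hh ω₀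
  intro x hx
  refine ContinuousAt.continuousWithinAt ?_
  rcases lt_trichotomy x (epsStar h ω₀) with hlt | heq | hgt
  · exact (hasDerivAt_extremalD hh hω₀ hη (by rw [hs]; exact ⟨hx, hlt⟩)).continuousAt
  · -- at the threshold, squeeze between multiples of the norm of the kernel
    subst heq
    rw [ContinuousAt, extremalD_eq_norm hh ω₀ le_rfl]
    set P := ‖kernelVec (ofReal_mem_halfPlane hh ω₀)‖ with hP
    have hlow : Tendsto (fun x : ℝ => min 1 (x / epsStar h ω₀) * P) (𝓝 (epsStar h ω₀)) (𝓝 P) := by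
      have : Continuous fun x : ℝ => min 1 (x / epsStar h ω₀) * P := by fun_prop
      have h1 := this.tendsto (epsStar h ω₀)
      simpa [div_self he.ne'] using h1
    refine tendsto_of_tendsto_of_tendsto_of_le_of_le' hlow tendsto_const_nhds ?_ ?_
    · filter_upwards [lt_mem_nhds he] with y hy
      refine mul_norm_le_extremalD hh ω₀ hy.le (by positivity) (min_le_left _ _) ?_
      calc _ ≤ y / epsStar h ω₀ * epsStar h ω₀ :=
            mul_le_mul_of_nonneg_right (min_le_right _ _) he.le
        _ = y := div_mul_cancel₀ _ he.ne'
    · filter_upwards [lt_mem_nhds he] with y hy using extremalD_le_norm hh ω₀ hy.le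
  · refine (continuousAt_const (y := ‖kernelVec (ofReal_mem_halfPlane hh ω₀)‖)).congr ?_
    filter_upwards [lt_mem_nhds hgt] with y hy using (extremalD_eq_norm hh ω₀ hy.le).symm

theorem hasDerivAt_log_extremalD {h ω₀ : ℝ} (hh : 0 < h) (hω₀ : 1 < ω₀) {η : ℝ → ℝ}
    (hη : ∀ ε ∈ solvable h ω₀, IsEta h ω₀ ε (η ε)) {ε : ℝ} (hε : ε ∈ solvable h ω₀) :
    HasDerivAt (fun x => Real.log (extremalD h ω₀ x)) (ε / (ε ^ 2 + η ε)) ε := by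
  have hε0 : 0 < ε := by rw [solvable_eq hh hω₀] at hε; exact hε.1
  have hU := norm_resolventVec_pos hh ω₀ (hη ε hε).1
  have := (hasDerivAt_extremalD hh hω₀ hη hε).log (extremalD_pos hh ω₀ hε0).ne'
  rw [(hη ε hε).norm_restrictOp hh, (hη ε hε).extremalD_eq hh hε0.le,
    mul_div_mul_right _ _ hU.ne'] at this
  exact this

end HardyExtrapolation

end

open HardyExtrapolation in
theorem lemma5p5 (h ω₀ : ℝ) (hh : 0 < h) (hω₀ : 1 < ω₀)
    (η : ℝ → ℝ) (u : ℝ → ℂ → ℂ)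
    (hη : ∀ ε ∈ HardyExtrapolation.solvable h ω₀, HardyExtrapolation.IsEta h ω₀ ε (η ε))
    (hu : ∀ ε ∈ HardyExtrapolation.solvable h ω₀,
      HardyExtrapolation.IsResolventSol h ω₀ (η ε) (u ε)) :
    -- `η(ε)` exists, and is unique, exactly for `0 < ε < ε_*`, where `0 < ε_* < 1`
    (0 < HardyExtrapolation.epsStar h ω₀ ∧ HardyExtrapolation.epsStar h ω₀ < 1 ∧
      HardyExtrapolation.solvable h ω₀ = Set.Ioo 0 (HardyExtrapolation.epsStar h ω₀) ∧
      ∀ ε ∈ HardyExtrapolation.solvable h ω₀, ∃! e : ℝ, HardyExtrapolation.IsEta h ω₀ ε e) ∧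
    -- the exact formula
    (∀ ε : ℝ, 0 < ε → ε ≤ 1 →
      IntervalIntegrable (HardyExtrapolation.integrand h ω₀ η) MeasureTheory.volume ε 1 ∧
      HardyExtrapolation.extremalD h ω₀ ε =
        HardyExtrapolation.extremalD h ω₀ 1 *
          Real.exp (-∫ t in ε..1, HardyExtrapolation.integrand h ω₀ η t)) ∧
    -- first formula for the exponent
    HardyExtrapolation.gammaExp h ω₀ =
      Filter.liminf
        (fun ε : ℝ =>
          ((Real.log ((ε + η ε / ε) * (HardyExtrapolation.intervalNorm (u ε)).toReal) /
            Real.log ε : ℝ) : EReal))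
        (nhdsWithin 0 (Set.Ioi 0)) ∧
    -- second formula for the exponent
    (∀ t : ℝ, 0 ≤ t →
      IntervalIntegrable (HardyExtrapolation.ratioFn h ω₀ η) MeasureTheory.volume 0 t) ∧
    HardyExtrapolation.gammaExp h ω₀ =
      Filter.liminf
        (fun t : ℝ =>
          (((1 / t) * ∫ x in (0 : ℝ)..t, HardyExtrapolation.ratioFn h ω₀ η x : ℝ) : EReal))
        Filter.atTop := by
  have he := epsStar_pos hh ω₀
  have he1 := epsStar_lt_one hh ω₀
  have hs := solvable_eq hh hω₀
  set ψ : ℝ → ℝ := fun x => Real.log (extremalD h ω₀ x) with hψdef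
  set q : ℝ → ℝ := fun t => t / (t ^ 2 + η t) with hq
  have hψ : ContinuousOn ψ (Set.Ioi 0) := (continuousOn_extremalD hh hω₀ hη).log
    fun x hx => (extremalD_pos hh ω₀ hx).ne'
  have hψd : ∀ t ∈ Set.Ioo 0 (epsStar h ω₀), HasDerivAt ψ (q t) t := fun t ht =>
    hasDerivAt_log_extremalD hh hω₀ hη (hs ▸ ht)
  have hψc : ∀ t, epsStar h ω₀ ≤ t → ψ t = ψ (epsStar h ω₀) := fun t ht => by
    simp only [hψdef, extremalD_eq_norm hh ω₀ ht, extremalD_eq_norm hh ω₀ le_rfl]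
  have hηpos : ∀ t ∈ Set.Ioo 0 (epsStar h ω₀), 0 < η t := fun t ht => (hη t (hs ▸ ht)).1
  have hqc : ContinuousOn q (Set.Ioo 0 (epsStar h ω₀)) := by
    refine continuousOn_id.div ((continuousOn_id.pow 2).add
      (hs ▸ continuousOn_eta hh hω₀ hη)) fun t ht => ?_
    have := hηpos t ht
    change t ^ 2 + η t ≠ 0
    positivity
  have hq1 : ∀ t ∈ Set.Ioo 0 (epsStar h ω₀), |t * q t| ≤ 1 := by
    intro t ht
    have h1 := hηpos t ht
    have h2 : t * q t = t ^ 2 / (t ^ 2 + η t) := by rw [hq]; ring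
    rw [h2, abs_of_nonneg (by positivity)]
    exact (div_le_one (by positivity)).2 (by linarith)
  have hint : integrand h ω₀ η = (Set.Ioo 0 (epsStar h ω₀)).indicator q := by
    rw [integrand, hs]
  have hratio : ratioFn h ω₀ η = {x : ℝ | Real.exp (-x) ∈ Set.Ioo 0 (epsStar h ω₀)}.indicator
      fun x => Real.exp (-x) * q (Real.exp (-x)) := by
    rw [ratioFn, hs]
    refine Set.indicator_congr fun x hx => ?_
    have h1 := hηpos _ hx
    have h2 : Real.exp (2 * x) * Real.exp (-x) ^ 2 = 1 := by
      rw [← Real.exp_nat_mul, ← Real.exp_add, Real.exp_eq_one_iff]; push_cast; ring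
    have h3 : 0 < Real.exp (2 * x) := Real.exp_pos _
    have h4 : 0 < Real.exp (-x) := Real.exp_pos _
    generalize Real.exp (2 * x) = E at h2 h3 ⊢
    generalize Real.exp (-x) = s at h1 h2 h4 ⊢
    rw [hq, ← mul_div_assoc, div_eq_div_iff (by positivity) (by positivity)]
    linear_combination (-η s) * h2
  refine ⟨⟨he, he1, hs, fun ε hε => ⟨η ε, hη ε hε, fun e he' => he'.unique hh hω₀ (hη ε hε)⟩⟩,
    fun ε hε hε1 => ?_, ?_, fun t ht => ?_, ?_⟩
  · rw [hint]
    obtain ⟨h1, h2⟩ := integral_indicator_eq_sub hψ hψd hψc hqc hq1 hε hε1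
    refine ⟨h1, ?_⟩
    rw [h2, neg_sub, Real.exp_sub, hψdef, Real.exp_log (extremalD_pos hh ω₀ hε),
      Real.exp_log (extremalD_pos hh ω₀ one_pos)]
    field_simp [(extremalD_pos hh ω₀ one_pos).ne']
  · refine Filter.liminf_congr ?_
    filter_upwards [Ioo_mem_nhdsGT he] with ε hε
    have hεs : ε ∈ solvable h ω₀ := hs ▸ hε
    have hη' := hη ε hεs
    rw [hη'.extremalD_eq hh hε.1.le, (hu ε hεs).intervalNorm_eq hh hη'.1, toReal_enorm,
      hη'.norm_restrictOp hh]
    have h1 : (ε + η ε / ε) * (ε * ‖resolventVec hh ω₀ (η ε)‖) =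
        (ε ^ 2 + η ε) * ‖resolventVec hh ω₀ (η ε)‖ := by
      have := hε.1.ne'
      field_simp
    rw [h1]
  · rw [hratio]
    exact (integral_indicator_exp_eq_sub hψ hψd hψc hqc hq1 ht).1
  · rw [hratio]
    exact liminf_div_log_eq fun t ht =>
      (integral_indicator_exp_eq_sub hψ hψd hψc hqc hq1 ht).2
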